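/- Let $(\Omega,\mathcal F,\mathbb P)$ be a probability space and let $\xi_k$, $k\ge 1$, be i.i.d. standard normal random variables on it. Let $\theta>0$, $\sigma>0$, $t>0$ and $0\le a<b\le \pi$. Put $h_k(x)=\sqrt{2/\pi}\,\sin(kx)$ and let $\dot W=\sum_{k\ge1}\xi_k h_k$ be the space-only white noise on $(0,\pi)$. Let $u$ be the solution of the heat equation $$u_t(s,x)-\theta u_{xx}(s,x)=\sigma\dot W(x),\quad s>0,\ 0<x<\pi,\qquad u(s,0)=u(s,\pi)=0,\quad u(0,x)=0,$$ defined by its Fourier expansion $$u(s,x)=\sum_{k=1}^\infty u_k(s)\,h_k(x),\qquad u_k(s)=\frac{\sigma}{\theta}\,\xi_k\,\frac{1-e^{-k^2\theta s}}{k^2}.$$ Then, with probability one, the series for $u(t,x)$ converges absolutely for every $x\in[0,\pi]$ and $u(t,\cdot)$ is differentiable on $[0,\pi]$ (one-sidedly at the end points), with derivative denoted $u_x(t,\cdot)$. For $M\ge1$ let $x_j=a+(b-a)j/M$, $j=0,\dots,M$, and define $$\check\theta^2_M=\frac{\sigma^2(b-a)}{\sum_{j=1}^M\big(u_x(t,x_j)-u_x(t,x_{j-1})\big)^2},\qquad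 \check\sigma^2_M=\frac{\theta^2\sum_{j=1}^M\big(u_x(t,x_j)-u_x(t,x_{j-1})\big)^2}{b-a}.$$ (i) If $\sigma$ is known, then $\check\theta^2_M$ is a strongly consistent and asymptotically normal estimator of $\theta^2$: as $M\to\infty$, $\check\theta^2_M\to\theta^2$ $\mathbb P$-almost surely, and $\sqrt M\,(\check\theta^2_M-\theta^2)\to\mathcal N(0,2\theta^4)$ in distribution. (ii) If $\theta$ is known, then $\check\sigma^2_M$ is a strongly consistent and asymptotically normal estimator of $\sigma^2$: as $M\to\infty$, $\check\sigma^2_M\to\sigma^2$ $\mathbb P$-almost surely, and $\sqrt M\,(\check\sigma^2_M-\sigma^2)\to\mathcal N(0,2\sigma^4)$ in distribution. -/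

import Mathlib

open Set Filter Topology MeasureTheory ProbabilityTheory

namespace SpaceOnlyNoise

noncomputable section

/-- The normalized Dirichlet eigenfunctions `h_k(x) = √(2/π) sin(kx)` of the Laplacian on
`(0, π)`, with eigenvalues `-k²`, for `k = 1, 2, …`. -/
def eigenfunction (k : ℕ) (x : ℝ) : ℝ :=
  √(2 / Real.pi) * Real.sin (k * x)

/-- The `k`-th Fourier mode (`k ≥ 1`) of the solution of the heat equation
`u_t - θ u_xx = σ Ẇ` on `(0, π)` with zero boundary and initial data, where `z` is the value of
`ξ_k = Ẇ(h_k)`:  `u_k(t) = (σ/θ) ξ_k (1 - exp(-k² θ t)) / k²`. -/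
def fourierMode (θ σ t : ℝ) (k : ℕ) (z : ℝ) : ℝ :=
  σ / θ * z * ((1 - Real.exp (-(k : ℝ) ^ 2 * θ * t)) / (k : ℝ) ^ 2)

/-- The mode starts from zero. -/
theorem fourierMode_zero (θ σ : ℝ) (k : ℕ) (z : ℝ) : fourierMode θ σ 0 k z = 0 := by
  simp [fourierMode]

/-- The mode solves `u_k' = -θ k² u_k + σ ξ_k`, the projection of the equation on `h_k`. -/
theorem hasDerivAt_fourierMode {θ : ℝ} (hθ : 0 < θ) (σ t : ℝ) {k : ℕ} (hk : 1 ≤ k) (z : ℝ) :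
    HasDerivAt (fun s => fourierMode θ σ s k z)
      (-θ * (k : ℝ) ^ 2 * fourierMode θ σ t k z + σ * z) t := by
  have hk' : (k : ℝ) ≠ 0 := by positivity
  have h1 : HasDerivAt (fun s : ℝ => -(k : ℝ) ^ 2 * θ * s) (-(k : ℝ) ^ 2 * θ) t := by
    exact ((hasDerivAt_id t).const_mul (-(k : ℝ) ^ 2 * θ)).congr_deriv (mul_one _)
  have h2 := (((h1.exp).const_sub 1).div_const ((k : ℝ) ^ 2)).const_mul (σ / θ * z)
  refine h2.congr_deriv ?_
  unfold fourierMode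
  field_simp
  ring

/-- The random field `u(t, x) = ∑_{k ≥ 1} u_k(t) h_k(x)`, the solution of
`u_t - θ u_xx = σ Ẇ(x)` for `t > 0`, `0 < x < π`, with `u(t, 0) = u(t, π) = 0` and `u(0, x) = 0`,
driven by the space-only white noise `Ẇ = ∑_{k ≥ 1} ξ_k h_k`.
The sequence `ξ` is indexed from `0`, so `ξ k` is the coefficient of `h_{k+1}`. -/
def solution {Ω : Type*} (θ σ : ℝ) (ξ : ℕ → Ω → ℝ) (t : ℝ) (ω : Ω) (x : ℝ) : ℝ :=
  ∑' k : ℕ, fourierMode θ σ t (k + 1) (ξ k ω) * eigenfunction (k + 1) x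

/-- The spatial derivative `u_x(t, ·)` on `[0, π]` (one-sided at the end points). -/
def solutionDeriv {Ω : Type*} (θ σ : ℝ) (ξ : ℕ → Ω → ℝ) (t : ℝ) (ω : Ω) (x : ℝ) : ℝ :=
  derivWithin (solution θ σ ξ t ω) (Icc 0 Real.pi) x

/-- The uniform grid `x_j = a + (b - a) j / M`, `j = 0, …, M`, of `[a, b]`. -/
def gridPoint (a b : ℝ) (M j : ℕ) : ℝ :=
  a + (b - a) * j / M

/-- `∑_{j=1}^M (y(x_j) - y(x_{j-1}))²` over the uniform grid. -/
def sumSqIncrements (a b : ℝ) (M : ℕ) (y : ℝ → ℝ) : ℝ :=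
  ∑ j ∈ Finset.Icc 1 M, (y (gridPoint a b M j) - y (gridPoint a b M (j - 1))) ^ 2

/-- The estimator of `θ²` from the observed profile `y`, when `σ` is known. -/
def thetaSqEstimator (σ a b : ℝ) (M : ℕ) (y : ℝ → ℝ) : ℝ :=
  σ ^ 2 * (b - a) / sumSqIncrements a b M y

/-- The estimator of `σ²` from the observed profile `y`, when `θ` is known. -/
def sigmaSqEstimator (θ a b : ℝ) (M : ℕ) (y : ℝ → ℝ) : ℝ :=
  θ ^ 2 * sumSqIncrements a b M y / (b - a)

end

end SpaceOnlyNoise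

namespace SpaceOnlyNoise

noncomputable section

/-! ### Deterministic analysis of the cosine series -/

/-- `√(2/π) cos((k+1)x)/(k+1)`, the negative of a primitive of the `(k+1)`-st eigenfunction. -/
def cosMode (k : ℕ) (x : ℝ) : ℝ :=
  √(2 / Real.pi) * (Real.cos ((k + 1 : ℝ) * x) / (k + 1))

/-- Dyadic partial sums of the cosine series with coefficients `z`. -/
def dyadicSum (z : ℕ → ℝ) (n : ℕ) (x : ℝ) : ℝ :=
  ∑ k ∈ Finset.range (2 ^ n), z k * cosMode k x

/-- The limit of the dyadic partial sums of the cosine series. -/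
def cosSeries (z : ℕ → ℝ) (x : ℝ) : ℝ :=
  limUnder atTop (fun n => dyadicSum z n x)

/-- Autocorrelation bound for the `n`-th dyadic block of the cosine series. -/
def blockBound (z : ℕ → ℝ) (n : ℕ) : ℝ :=
  ∑ d ∈ Finset.Ioo (-(2 ^ n : ℤ)) (2 ^ n),
    |∑ p ∈ ((Finset.Ico (2 ^ n) (2 ^ (n + 1))) ×ˢ (Finset.Ico (2 ^ n) (2 ^ (n + 1)))).filter
      (fun p : ℕ × ℕ => (p.1 : ℤ) - p.2 = d), z p.1 / (p.1 + 1) * (z p.2 / (p.2 + 1))|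

lemma sq_sum_mul_cos_le (s : Finset ℕ) (D : Finset ℤ)
    (hD : ∀ k ∈ s, ∀ l ∈ s, (k : ℤ) - l ∈ D) (a : ℕ → ℝ) (x : ℝ) :
    (∑ k ∈ s, a k * Real.cos ((k + 1 : ℝ) * x)) ^ 2 ≤
      ∑ d ∈ D, |∑ p ∈ (s ×ˢ s).filter (fun p : ℕ × ℕ => (p.1 : ℤ) - p.2 = d),
        a p.1 * a p.2| := by
  have h1 : (∑ k ∈ s, a k * Real.cos ((k + 1 : ℝ) * x)) ^ 2 +
      (∑ k ∈ s, a k * Real.sin ((k + 1 : ℝ) * x)) ^ 2 =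
      ∑ p ∈ s ×ˢ s, a p.1 * a p.2 * Real.cos ((((p.1 : ℤ) - p.2 : ℤ) : ℝ) * x) := by
    rw [sq, sq, Finset.sum_mul_sum, Finset.sum_mul_sum, Finset.sum_product,
      ← Finset.sum_add_distrib]
    refine Finset.sum_congr rfl fun k _ => ?_
    rw [← Finset.sum_add_distrib]
    refine Finset.sum_congr rfl fun l _ => ?_
    have : (((k : ℤ) - l : ℤ) : ℝ) * x = (k + 1 : ℝ) * x - (l + 1 : ℝ) * x := by
      push_cast; ring
    rw [this, Real.cos_sub]
    ring
  have h2 : ∑ p ∈ s ×ˢ s, a p.1 * a p.2 * Real.cos ((((p.1 : ℤ) - p.2 : ℤ) : ℝ) * x) =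
      ∑ d ∈ D, Real.cos (d * x) *
        ∑ p ∈ (s ×ˢ s).filter (fun p : ℕ × ℕ => (p.1 : ℤ) - p.2 = d), a p.1 * a p.2 := by
    rw [← Finset.sum_fiberwise_of_maps_to (t := D) (g := fun p : ℕ × ℕ => (p.1 : ℤ) - p.2)]
    · refine Finset.sum_congr rfl fun d _ => ?_
      rw [Finset.mul_sum]
      refine Finset.sum_congr rfl fun p hp => ?_
      rw [(Finset.mem_filter.1 hp).2]
      ring
    · intro p hp
      rw [Finset.mem_product] at hp
      exact hD _ hp.1 _ hp.2
  calc (∑ k ∈ s, a k * Real.cos ((k + 1 : ℝ) * x)) ^ 2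
      ≤ ∑ d ∈ D, Real.cos (d * x) *
        ∑ p ∈ (s ×ˢ s).filter (fun p : ℕ × ℕ => (p.1 : ℤ) - p.2 = d), a p.1 * a p.2 := by
        rw [← h2, ← h1]; exact le_add_of_nonneg_right (sq_nonneg _)
    _ ≤ _ := by
        refine Finset.sum_le_sum fun d _ => (le_abs_self _).trans ?_
        rw [abs_mul]
        exact mul_le_of_le_one_left (abs_nonneg _) (Real.abs_cos_le_one _)

lemma blockBound_nonneg (z : ℕ → ℝ) (n : ℕ) : 0 ≤ blockBound z n :=
  Finset.sum_nonneg fun _ _ => abs_nonneg _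

lemma abs_dyadicSum_succ_sub_le (z : ℕ → ℝ) (n : ℕ) (x : ℝ) :
    |dyadicSum z (n + 1) x - dyadicSum z n x| ≤ √(2 / Real.pi) * √(blockBound z n) := by
  have h : dyadicSum z (n + 1) x - dyadicSum z n x = √(2 / Real.pi) *
      ∑ k ∈ Finset.Ico (2 ^ n) (2 ^ (n + 1)), z k / (k + 1) * Real.cos ((k + 1 : ℝ) * x) := by
    unfold dyadicSum
    rw [← Finset.sum_Ico_eq_sub _ (Nat.pow_le_pow_right (by norm_num) n.le_succ), Finset.mul_sum]
    refine Finset.sum_congr rfl fun k _ => ?_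
    unfold cosMode
    ring
  rw [h, abs_mul, abs_of_nonneg (Real.sqrt_nonneg _)]
  refine mul_le_mul_of_nonneg_left (Real.abs_le_sqrt ?_) (Real.sqrt_nonneg _)
  refine sq_sum_mul_cos_le _ _ (fun k hk l hl => ?_) _ x
  rw [Finset.mem_Ico, pow_succ] at hk hl
  rw [Finset.mem_Ioo]
  zify at hk hl
  constructor <;> linarith [hk.1, hk.2, hl.1, hl.2]

lemma abs_cosMode_le (k : ℕ) (x : ℝ) : |cosMode k x| ≤ √(2 / Real.pi) / (k + 1) := by
  unfold cosMode
  rw [abs_mul, abs_div, abs_of_nonneg (Real.sqrt_nonneg _),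
    abs_of_nonneg (by positivity : (0 : ℝ) ≤ k + 1),
    ← mul_div_assoc]
  gcongr
  exact mul_le_of_le_one_right (Real.sqrt_nonneg _) (Real.abs_cos_le_one _)

lemma tendstoUniformly_dyadicSum {z : ℕ → ℝ} (hz : Summable fun n => √(blockBound z n)) :
    TendstoUniformly (dyadicSum z) (cosSeries z) atTop := by
  have h := tendstoUniformly_tsum_nat (f := fun n x => dyadicSum z (n + 1) x - dyadicSum z n x)
    (hz.mul_left √(2 / Real.pi)) (fun n x => abs_dyadicSum_succ_sub_le z n x)
  have h2 : TendstoUniformly (dyadicSum z)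
      (fun x => dyadicSum z 0 x + ∑' n, (dyadicSum z (n + 1) x - dyadicSum z n x)) atTop := by
    rw [Metric.tendstoUniformly_iff] at h ⊢
    intro ε hε
    filter_upwards [h ε hε] with n hn x
    have := hn x
    rw [Finset.sum_range_sub (fun n => dyadicSum z n x), Real.dist_eq] at this
    rw [Real.dist_eq]
    convert this using 2
    ring
  convert h2 using 1
  funext x
  exact (h2.tendsto_at x).limUnder_eq

lemma exists_abs_cosSeries_le {z : ℕ → ℝ} (hz : Summable fun n => √(blockBound z n)) :
    ∃ C, 0 ≤ C ∧ ∀ x, |cosSeries z x| ≤ C := by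
  have h := (Metric.tendstoUniformly_iff.1 (tendstoUniformly_dyadicSum hz) 1 one_pos).exists
  obtain ⟨n, hn⟩ := h
  refine ⟨1 + ∑ k ∈ Finset.range (2 ^ n), |z k| * (√(2 / Real.pi) / (k + 1)), by positivity,
    fun x => ?_⟩
  have h1 := (hn x).le
  rw [Real.dist_eq] at h1
  have h2 : |dyadicSum z n x| ≤ ∑ k ∈ Finset.range (2 ^ n), |z k| * (√(2 / Real.pi) / (k + 1)) := by
    refine (Finset.abs_sum_le_sum_abs _ _).trans (Finset.sum_le_sum fun k _ => ?_)
    rw [abs_mul]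
    exact mul_le_mul_of_nonneg_left (abs_cosMode_le k x) (abs_nonneg _)
  have := abs_sub_abs_le_abs_sub (cosSeries z x) (dyadicSum z n x)
  linarith

/-! ### The smooth remainder -/

/-- The coefficients `z_k exp(-(k+1)²θt)`. -/
def dampedCoeff (θ t : ℝ) (z : ℕ → ℝ) (k : ℕ) : ℝ :=
  z k * Real.exp (-(k + 1 : ℝ) ^ 2 * θ * t)

/-- The smooth part `∑ z_k exp(-(k+1)²θt) √(2/π) cos((k+1)x)/(k+1)` of the profile. -/
def dampedSeries (θ t : ℝ) (z : ℕ → ℝ) (x : ℝ) : ℝ :=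
  ∑' k, dampedCoeff θ t z k * cosMode k x

lemma summable_abs_dampedCoeff_mul {θ t : ℝ} (hθ : 0 < θ) (ht : 0 < t) {z : ℕ → ℝ}
    (hz : Summable fun k : ℕ => |z k| / (k + 1 : ℝ) ^ 2) :
    Summable fun k : ℕ => |dampedCoeff θ t z k| * (k + 1 : ℝ) := by
  refine Summable.of_nonneg_of_le (fun k => by positivity) (fun k => ?_)
    (hz.mul_left (2 / (θ * t) ^ 2))
  unfold dampedCoeff
  rw [abs_mul, Real.abs_exp]
  have hk : (1 : ℝ) ≤ k + 1 := by linarith [(Nat.cast_nonneg k : (0 : ℝ) ≤ k)]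
  set m : ℝ := k + 1
  have hy : 0 < m ^ 2 * θ * t := by positivity
  have h1 : (m ^ 2 * θ * t) ^ 2 / 2 ≤ Real.exp (m ^ 2 * θ * t) := by
    have := Real.pow_div_factorial_le_exp _ hy.le 2
    simpa using this
  have h2 : Real.exp (-m ^ 2 * θ * t) ≤ 2 / (m ^ 2 * θ * t) ^ 2 := by
    rw [show -m ^ 2 * θ * t = -(m ^ 2 * θ * t) by ring, Real.exp_neg, ← inv_div]
    exact inv_anti₀ (by positivity) h1
  calc |z k| * Real.exp (-m ^ 2 * θ * t) * m
      ≤ |z k| * (2 / (m ^ 2 * θ * t) ^ 2) * m := by gcongr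
    _ = 2 / (θ * t) ^ 2 * (|z k| / m ^ 3) := by field_simp
    _ ≤ 2 / (θ * t) ^ 2 * (|z k| / m ^ 2) := by
        gcongr ?_ * (|z k| / ?_)
        exact pow_le_pow_right₀ hk (by norm_num)

section Damped

variable {q : ℕ → ℝ}

lemma summable_mul_cosMode (hq : Summable fun k : ℕ => |q k| * (k + 1 : ℝ)) (x : ℝ) :
    Summable fun k => q k * cosMode k x := by
  refine Summable.of_norm_bounded (hq.mul_left √(2 / Real.pi)) fun k => ?_
  rw [Real.norm_eq_abs, abs_mul, mul_left_comm]
  refine mul_le_mul_of_nonneg_left ((abs_cosMode_le k x).trans ?_) (abs_nonneg _)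
  have hk : (1 : ℝ) ≤ k + 1 := by linarith [(Nat.cast_nonneg k : (0 : ℝ) ≤ k)]
  rw [div_le_iff₀ (by positivity), mul_assoc]
  exact le_mul_of_one_le_right (Real.sqrt_nonneg _) (by nlinarith)

lemma tendstoUniformly_sum_mul_cosMode (hq : Summable fun k : ℕ => |q k| * (k + 1 : ℝ)) :
    TendstoUniformly (fun n x => ∑ k ∈ Finset.range n, q k * cosMode k x)
      (fun x => ∑' k, q k * cosMode k x) atTop := by
  refine tendstoUniformly_tsum_nat (hq.mul_left √(2 / Real.pi)) fun k x => ?_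
  rw [Real.norm_eq_abs, abs_mul, mul_left_comm]
  refine mul_le_mul_of_nonneg_left ((abs_cosMode_le k x).trans ?_) (abs_nonneg _)
  have hk : (1 : ℝ) ≤ k + 1 := by linarith [(Nat.cast_nonneg k : (0 : ℝ) ≤ k)]
  rw [div_le_iff₀ (by positivity), mul_assoc]
  exact le_mul_of_one_le_right (Real.sqrt_nonneg _) (by nlinarith)

lemma abs_cosMode_sub_le (k : ℕ) (x y : ℝ) :
    |cosMode k x - cosMode k y| ≤ √(2 / Real.pi) * |x - y| := by
  have hk : (0 : ℝ) < k + 1 := by positivity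
  have h : |Real.cos ((k + 1 : ℝ) * x) - Real.cos ((k + 1 : ℝ) * y)| ≤ (k + 1 : ℝ) * |x - y| := by
    have h := Real.abs_cos_sub_cos_le ((k + 1 : ℝ) * x) ((k + 1 : ℝ) * y)
    rwa [← mul_sub, abs_mul, abs_of_pos hk] at h
  unfold cosMode
  rw [← mul_sub, ← sub_div, abs_mul, abs_of_nonneg (Real.sqrt_nonneg _), abs_div, abs_of_pos hk]
  refine mul_le_mul_of_nonneg_left ?_ (Real.sqrt_nonneg _)
  rwa [div_le_iff₀ hk, mul_comm |x - y|]

lemma abs_cosMode_second_diff_le (k : ℕ) (x h : ℝ) :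
    |cosMode k (x + h) - 2 * cosMode k x + cosMode k (x - h)| ≤
      √(2 / Real.pi) * (k + 1) * h ^ 2 := by
  have hk : (0 : ℝ) < k + 1 := by positivity
  have h1 : cosMode k (x + h) - 2 * cosMode k x + cosMode k (x - h) =
      √(2 / Real.pi) * ((-2 * Real.cos ((k + 1 : ℝ) * x) *
        (1 - Real.cos ((k + 1 : ℝ) * h))) / (k + 1)) := by
    unfold cosMode
    rw [mul_add, mul_sub, Real.cos_add, Real.cos_sub]
    ring
  have h2 : |1 - Real.cos ((k + 1 : ℝ) * h)| ≤ ((k + 1 : ℝ) * h) ^ 2 / 2 := by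
    rw [abs_of_nonneg (by linarith [Real.cos_le_one ((k + 1 : ℝ) * h)])]
    linarith [Real.one_sub_sq_div_two_le_cos (x := (k + 1 : ℝ) * h)]
  rw [h1, abs_mul, abs_of_nonneg (Real.sqrt_nonneg _), mul_assoc √(2 / Real.pi)]
  refine mul_le_mul_of_nonneg_left ?_ (Real.sqrt_nonneg _)
  rw [abs_div, abs_of_pos hk, div_le_iff₀ hk, abs_mul, abs_mul]
  have h3 := Real.abs_cos_le_one ((k + 1 : ℝ) * x)
  have h4 : |(-2 : ℝ)| = 2 := by norm_num
  rw [h4]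
  calc 2 * |Real.cos ((k + 1 : ℝ) * x)| * |1 - Real.cos ((k + 1 : ℝ) * h)|
      ≤ 2 * 1 * (((k + 1 : ℝ) * h) ^ 2 / 2) := by gcongr
    _ = _ := by ring

lemma abs_tsum_mul_cosMode_sub_le (hq : Summable fun k : ℕ => |q k| * (k + 1 : ℝ)) (x y : ℝ) :
    |(∑' k, q k * cosMode k x) - ∑' k, q k * cosMode k y| ≤
      √(2 / Real.pi) * (∑' k : ℕ, |q k| * (k + 1 : ℝ)) * |x - y| := by
  rw [← (summable_mul_cosMode hq x).tsum_sub (summable_mul_cosMode hq y)]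
  have h := (hq.mul_left √(2 / Real.pi)).mul_right |x - y|
  change ‖(∑' k : ℕ, (_ : ℝ) : ℝ)‖ ≤ _
  refine (tsum_of_norm_bounded h.hasSum fun k => ?_).trans_eq
    (by rw [tsum_mul_right, tsum_mul_left])
  rw [Real.norm_eq_abs, ← mul_sub, abs_mul]
  have hk : (1 : ℝ) ≤ k + 1 := by linarith [(Nat.cast_nonneg k : (0 : ℝ) ≤ k)]
  calc |q k| * |cosMode k x - cosMode k y|
      ≤ |q k| * (√(2 / Real.pi) * |x - y|) := by gcongr; exact abs_cosMode_sub_le k x y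
    _ = √(2 / Real.pi) * (|q k| * 1) * |x - y| := by ring
    _ ≤ _ := by gcongr

lemma abs_tsum_mul_cosMode_second_diff_le (hq : Summable fun k : ℕ => |q k| * (k + 1 : ℝ))
    (x h : ℝ) :
    |(∑' k, q k * cosMode k (x + h)) - 2 * (∑' k, q k * cosMode k x) +
        ∑' k, q k * cosMode k (x - h)| ≤
      √(2 / Real.pi) * (∑' k : ℕ, |q k| * (k + 1 : ℝ)) * h ^ 2 := by
  have s1 := summable_mul_cosMode hq (x + h)
  have s2 := (summable_mul_cosMode hq x).mul_left 2
  have s3 := summable_mul_cosMode hq (x - h)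
  rw [← tsum_mul_left, ← s1.tsum_sub s2, ← (s1.sub s2).tsum_add s3]
  have hs := (hq.mul_left √(2 / Real.pi)).mul_right (h ^ 2)
  change ‖(∑' k : ℕ, (_ : ℝ) : ℝ)‖ ≤ _
  refine (tsum_of_norm_bounded hs.hasSum fun k => ?_).trans_eq
    (by rw [tsum_mul_right, tsum_mul_left])
  have e : q k * cosMode k (x + h) - 2 * (q k * cosMode k x) + q k * cosMode k (x - h) =
    q k * (cosMode k (x + h) - 2 * cosMode k x + cosMode k (x - h)) := by ring
  rw [Real.norm_eq_abs, e, abs_mul]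
  calc |q k| * |cosMode k (x + h) - 2 * cosMode k x + cosMode k (x - h)|
      ≤ |q k| * (√(2 / Real.pi) * (k + 1) * h ^ 2) := by
        gcongr; exact abs_cosMode_second_diff_le k x h
    _ = _ := by ring

end Damped

/-! ### The profile and its derivative -/

lemma summable_fourierMode_mul_eigenfunction {θ σ t : ℝ} (hθ : 0 < θ) (ht : 0 < t)
    {z : ℕ → ℝ} (hz : Summable fun k : ℕ => |z k| / (k + 1 : ℝ) ^ 2) (x : ℝ) :
    Summable fun k : ℕ => fourierMode θ σ t (k + 1) (z k) * eigenfunction (k + 1) x := by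
  refine Summable.of_norm_bounded (hz.mul_left (|σ / θ| * √(2 / Real.pi))) fun k => ?_
  unfold fourierMode eigenfunction
  push_cast
  have h1 : |1 - Real.exp (-(k + 1 : ℝ) ^ 2 * θ * t)| ≤ 1 := by
    have h2 : Real.exp (-(k + 1 : ℝ) ^ 2 * θ * t) ≤ 1 := by
      rw [Real.exp_le_one_iff]
      have : 0 ≤ (k + 1 : ℝ) ^ 2 * θ * t := by positivity
      linarith
    rw [abs_of_nonneg (by linarith)]
    linarith [Real.exp_pos (-(k + 1 : ℝ) ^ 2 * θ * t)]
  have h3 : (0 : ℝ) < (k + 1 : ℝ) ^ 2 := by positivity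
  rw [Real.norm_eq_abs, abs_mul, abs_mul, abs_mul (σ / θ), abs_mul (√(2 / Real.pi)),
    abs_div _ ((k + 1 : ℝ) ^ 2),
    abs_of_pos h3, abs_of_nonneg (Real.sqrt_nonneg _)]
  calc |σ / θ| * |z k| * (|1 - Real.exp (-(k + 1 : ℝ) ^ 2 * θ * t)| / (k + 1 : ℝ) ^ 2) *
        (√(2 / Real.pi) * |Real.sin ((k + 1 : ℝ) * x)|)
      ≤ |σ / θ| * |z k| * (1 / (k + 1 : ℝ) ^ 2) * (√(2 / Real.pi) * 1) := by
        gcongr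
        exact Real.abs_sin_le_one _
    _ = _ := by ring

lemma hasDerivAt_fourierMode_mul_eigenfunction (θ σ t : ℝ) (z : ℕ → ℝ) (k : ℕ) (x : ℝ) :
    HasDerivAt (fun x => fourierMode θ σ t (k + 1) (z k) * eigenfunction (k + 1) x)
      (σ / θ * (z k * cosMode k x - dampedCoeff θ t z k * cosMode k x)) x := by
  have h1 : HasDerivAt (fun x : ℝ => ((k + 1 : ℕ) : ℝ) * x) ((k + 1 : ℕ) : ℝ) x := by
    simpa using (hasDerivAt_id x).const_mul ((k + 1 : ℕ) : ℝ)
  have h2 := (h1.sin.const_mul √(2 / Real.pi)).const_mul (fourierMode θ σ t (k + 1) (z k))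
  refine h2.congr_deriv ?_
  unfold fourierMode cosMode dampedCoeff
  push_cast
  have hk : (k + 1 : ℝ) ≠ 0 := by positivity
  field_simp

lemma hasDerivAt_solution {Ω : Type*} {θ σ t : ℝ} (hθ : 0 < θ) (ht : 0 < t)
    {ξ : ℕ → Ω → ℝ} {ω : Ω} (h1 : Summable fun k : ℕ => |ξ k ω| / (k + 1 : ℝ) ^ 2)
    (h2 : Summable fun n => √(blockBound (fun k => ξ k ω) n)) (x : ℝ) :
    HasDerivAt (solution θ σ ξ t ω)
      (σ / θ * (cosSeries (fun k => ξ k ω) x - dampedSeries θ t (fun k => ξ k ω) x)) x := by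
  have hpow : Tendsto (fun n : ℕ => 2 ^ n) atTop atTop :=
    tendsto_pow_atTop_atTop_of_one_lt (by norm_num)
  have hS : TendstoUniformly (fun n x => ∑ k ∈ Finset.range (2 ^ n),
      dampedCoeff θ t (fun k => ξ k ω) k * cosMode k x)
      (dampedSeries θ t (fun k => ξ k ω)) atTop := fun u hu =>
    hpow.eventually (tendstoUniformly_sum_mul_cosMode (summable_abs_dampedCoeff_mul hθ ht h1) u hu)
  have hD := (tendstoUniformly_dyadicSum h2).sub hS
  have hD' : TendstoUniformly (fun n x => σ / θ * (dyadicSum (fun k => ξ k ω) n x -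
      ∑ k ∈ Finset.range (2 ^ n), dampedCoeff θ t (fun k => ξ k ω) k * cosMode k x))
      (fun x => σ / θ * (cosSeries (fun k => ξ k ω) x - dampedSeries θ t (fun k => ξ k ω) x))
      atTop := (uniformContinuous_const_smul (σ / θ)).comp_tendstoUniformly hD
  refine hasDerivAt_of_tendstoUniformly (f := fun n x => ∑ k ∈ Finset.range (2 ^ n),
    fourierMode θ σ t (k + 1) (ξ k ω) * eigenfunction (k + 1) x) hD'
    (Eventually.of_forall fun n y => ?_)
    (fun y => ?_) x
  · refine (HasDerivAt.fun_sum fun k _ =>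
      hasDerivAt_fourierMode_mul_eigenfunction θ σ t (fun k => ξ k ω) k y).congr_deriv ?_
    unfold dyadicSum
    rw [← Finset.mul_sum, Finset.sum_sub_distrib]
  · exact (summable_fourierMode_mul_eigenfunction hθ ht h1 y).hasSum.tendsto_sum_nat.comp hpow

lemma solutionDeriv_eq {Ω : Type*} {θ σ t : ℝ} (hθ : 0 < θ) (ht : 0 < t)
    {ξ : ℕ → Ω → ℝ} {ω : Ω} (h1 : Summable fun k : ℕ => |ξ k ω| / (k + 1 : ℝ) ^ 2)
    (h2 : Summable fun n => √(blockBound (fun k => ξ k ω) n)) {x : ℝ} (hx : x ∈ Icc 0 Real.pi) :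
    solutionDeriv θ σ ξ t ω x =
      σ / θ * (cosSeries (fun k => ξ k ω) x - dampedSeries θ t (fun k => ξ k ω) x) :=
  (hasDerivAt_solution hθ ht h1 h2 x).hasDerivWithinAt.derivWithin
    (uniqueDiffOn_Icc Real.pi_pos x hx)

/-! ### Sums of squared increments -/

lemma sumSqIncrements_eq (a b : ℝ) (M : ℕ) (y : ℝ → ℝ) :
    sumSqIncrements a b M y =
      ∑ j ∈ Finset.range M, (y (gridPoint a b M (j + 1)) - y (gridPoint a b M j)) ^ 2 := by
  unfold sumSqIncrements
  have h := Finset.sum_Ico_add' (fun j => (y (gridPoint a b M j) -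
    y (gridPoint a b M (j - 1))) ^ 2) 0 M 1
  rw [Finset.range_eq_Ico]
  exact h.symm

lemma gridPoint_succ_sub (a b : ℝ) (M j : ℕ) :
    gridPoint a b M (j + 1) - gridPoint a b M j = (b - a) / M := by
  unfold gridPoint
  push_cast
  ring

lemma gridPoint_mem_Icc {a b : ℝ} (hab : a ≤ b) {M j : ℕ} (hj : j ≤ M) :
    gridPoint a b M j ∈ Icc a b := by
  unfold gridPoint
  have h1 : (j : ℝ) / M ≤ 1 := div_le_one_of_le₀ (by exact_mod_cast hj) (by positivity)
  have h2 : (0 : ℝ) ≤ (j : ℝ) / M := by positivity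
  rw [mul_div_assoc]
  constructor
  · nlinarith
  · nlinarith

lemma sum_mul_increments_by_parts (f g : ℕ → ℝ) (M : ℕ) :
    ∑ j ∈ Finset.range (M + 1), (f (j + 1) - f j) * g j =
      f (M + 1) * g M - f 0 * g 0 - ∑ j ∈ Finset.range M, f (j + 1) * (g (j + 1) - g j) := by
  induction M with
  | zero => simp; ring
  | succ M ih => rw [Finset.sum_range_succ, ih, Finset.sum_range_succ _ M]; ring

lemma abs_sum_increments_mul_le {f g : ℕ → ℝ} {C A B : ℝ} (M : ℕ) (hC : 0 ≤ C)
    (hf : ∀ j, |f j| ≤ C) (hg : ∀ j, |g j| ≤ A) (hgg : ∀ j, |g (j + 1) - g j| ≤ B) :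
    |∑ j ∈ Finset.range M, (f (j + 1) - f j) * g j| ≤ 2 * C * A + M * (C * B) := by
  have hA : 0 ≤ A := (abs_nonneg _).trans (hg 0)
  have hB : 0 ≤ B := (abs_nonneg _).trans (hgg 0)
  cases M with
  | zero => simp; positivity
  | succ M =>
    rw [sum_mul_increments_by_parts]
    have h1 : |∑ j ∈ Finset.range M, f (j + 1) * (g (j + 1) - g j)| ≤ M * (C * B) := by
      refine (Finset.abs_sum_le_sum_abs _ _).trans
        ((Finset.sum_le_card_nsmul _ _ (C * B) fun j _ => ?_).trans_eq (by simp))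
      rw [abs_mul]
      exact mul_le_mul (hf _) (hgg _) (abs_nonneg _) hC
    have h2 : |f (M + 1) * g M| ≤ C * A := by
      rw [abs_mul]; exact mul_le_mul (hf _) (hg _) (abs_nonneg _) hC
    have h3 : |f 0 * g 0| ≤ C * A := by
      rw [abs_mul]; exact mul_le_mul (hf _) (hg _) (abs_nonneg _) hC
    have h4 := abs_sub (f (M + 1) * g M - f 0 * g 0)
      (∑ j ∈ Finset.range M, f (j + 1) * (g (j + 1) - g j))
    have h5 := abs_sub (f (M + 1) * g M) (f 0 * g 0)
    have h6 : (0 : ℝ) ≤ C * B := mul_nonneg hC hB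
    push_cast
    nlinarith

lemma exists_abs_sumSqIncrements_sub_le {a b C L : ℝ} (hab : a ≤ b) {B S : ℝ → ℝ} (hC : 0 ≤ C)
    (hB : ∀ x, |B x| ≤ C) (hS : ∀ x y, |S x - S y| ≤ L * |x - y|)
    (hS2 : ∀ x h, |S (x + h) - 2 * S x + S (x - h)| ≤ L * h ^ 2) :
    ∃ K, ∀ M : ℕ, |sumSqIncrements a b M (fun x => B x - S x) - sumSqIncrements a b M B| ≤
      K / M := by
  refine ⟨2 * (2 * C * (L * (b - a)) + C * (L * (b - a) ^ 2)) + (L * (b - a)) ^ 2, fun M => ?_⟩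
  rcases Nat.eq_zero_or_pos M with rfl | hM
  · simp [sumSqIncrements_eq]
  have hM' : (0 : ℝ) < M := by exact_mod_cast hM
  set h := (b - a) / M with hh
  have hh0 : 0 ≤ h := div_nonneg (sub_nonneg.2 hab) hM'.le
  set x := gridPoint a b M with hx
  have hxs : ∀ j, x (j + 1) = x j + h := fun j => by
    rw [hh, ← gridPoint_succ_sub a b M j]; ring
  have e : sumSqIncrements a b M (fun x => B x - S x) - sumSqIncrements a b M B =
      -2 * ∑ j ∈ Finset.range M, (B (x (j + 1)) - B (x j)) * (S (x (j + 1)) - S (x j)) +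
      ∑ j ∈ Finset.range M, (S (x (j + 1)) - S (x j)) ^ 2 := by
    rw [sumSqIncrements_eq, sumSqIncrements_eq, ← Finset.sum_sub_distrib, Finset.mul_sum,
      ← Finset.sum_add_distrib]
    exact Finset.sum_congr rfl fun j _ => by ring
  have hg : ∀ j, |S (x (j + 1)) - S (x j)| ≤ L * h := fun j => by
    refine (hS _ _).trans_eq ?_
    rw [hxs, add_sub_cancel_left, abs_of_nonneg hh0]
  have hgg : ∀ j, |(S (x (j + 1 + 1)) - S (x (j + 1))) - (S (x (j + 1)) - S (x j))| ≤ L * h ^ 2 :=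
    fun j => by
      convert hS2 (x (j + 1)) h using 2
      rw [← hxs, show x (j + 1) - h = x j by rw [hxs]; ring]
      ring
  have h1 := abs_sum_increments_mul_le (f := fun j => B (x j))
    (g := fun j => S (x (j + 1)) - S (x j)) M hC (fun j => hB _) hg hgg
  have h2 : |∑ j ∈ Finset.range M, (S (x (j + 1)) - S (x j)) ^ 2| ≤ M * (L * h) ^ 2 := by
    refine (Finset.abs_sum_le_sum_abs _ _).trans
      ((Finset.sum_le_card_nsmul _ _ ((L * h) ^ 2) fun j _ => ?_).trans_eq (by simp))
    rw [abs_pow]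
    exact pow_le_pow_left₀ (abs_nonneg _) (hg j) 2
  rw [e]
  refine (abs_add_le _ _).trans ?_
  rw [abs_mul, show |(-2 : ℝ)| = 2 by norm_num]
  refine (add_le_add (mul_le_mul_of_nonneg_left h1 zero_le_two) h2).trans_eq ?_
  rw [hh]
  field_simp

/-- Replacing `u_x` by its rough part changes the sum of squared increments by `O(1/M)`. -/
lemma exists_abs_sumSqIncrements_solutionDeriv_sub_le {Ω : Type*} {θ σ t a b : ℝ}
    (hθ : 0 < θ) (ht : 0 < t) (ha : 0 ≤ a) (hab : a ≤ b) (hb : b ≤ Real.pi)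
    {ξ : ℕ → Ω → ℝ} {ω : Ω} (h1 : Summable fun k : ℕ => |ξ k ω| / (k + 1 : ℝ) ^ 2)
    (h2 : Summable fun n => √(blockBound (fun k => ξ k ω) n)) :
    ∃ K, ∀ M : ℕ, |sumSqIncrements a b M (solutionDeriv θ σ ξ t ω) -
      (σ / θ) ^ 2 * sumSqIncrements a b M (cosSeries (fun k => ξ k ω))| ≤ K / M := by
  obtain ⟨C, hC, hB⟩ := exists_abs_cosSeries_le h2
  have hq := summable_abs_dampedCoeff_mul hθ ht h1
  obtain ⟨K, hK⟩ := exists_abs_sumSqIncrements_sub_le hab hC hB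
    (abs_tsum_mul_cosMode_sub_le hq) (abs_tsum_mul_cosMode_second_diff_le hq)
  refine ⟨(σ / θ) ^ 2 * K, fun M => ?_⟩
  have e : sumSqIncrements a b M (solutionDeriv θ σ ξ t ω) = (σ / θ) ^ 2 *
      sumSqIncrements a b M (fun x => cosSeries (fun k => ξ k ω) x -
        ∑' k, dampedCoeff θ t (fun k => ξ k ω) k * cosMode k x) := by
    rw [sumSqIncrements_eq, sumSqIncrements_eq, Finset.mul_sum]
    refine Finset.sum_congr rfl fun j hj => ?_
    have hmem : ∀ i ≤ M, gridPoint a b M i ∈ Icc 0 Real.pi := fun i hi =>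
      Icc_subset_Icc ha hb (gridPoint_mem_Icc hab hi)
    rw [Finset.mem_range] at hj
    rw [solutionDeriv_eq hθ ht h1 h2 (hmem _ hj), solutionDeriv_eq hθ ht h1 h2 (hmem _ hj.le),
      ← mul_sub, mul_pow]
    rfl
  rw [e, ← mul_sub, abs_mul, abs_of_nonneg (sq_nonneg _), mul_div_assoc]
  exact mul_le_mul_of_nonneg_left (hK M) (sq_nonneg _)

/-! ### Random variables with moments of all orders -/

section AllMoments

variable {Ω : Type*} [MeasurableSpace Ω] {P : Measure Ω}

/-- All moments of `f` are finite. -/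
def HasAllMoments (f : Ω → ℝ) (P : Measure Ω) : Prop :=
  ∀ p : ℕ, MemLp f p P

namespace HasAllMoments

variable {f g : Ω → ℝ}

lemma integrable (hf : HasAllMoments f P) : Integrable f P :=
  memLp_one_iff_integrable.1 (by simpa using hf 1)

lemma memLp_two (hf : HasAllMoments f P) : MemLp f 2 P := by simpa using hf 2

lemma mul (hf : HasAllMoments f P) (hg : HasAllMoments g P) :
    HasAllMoments (fun ω => f ω * g ω) P := fun p => by
  have : ENNReal.HolderTriple ((2 * p : ℕ) : ENNReal) ((2 * p : ℕ) : ENNReal) (p : ENNReal) := by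
    constructor
    push_cast
    rw [ENNReal.mul_inv (by simp) (by simp), ← two_mul, ← mul_assoc,
      ENNReal.mul_inv_cancel (by simp) (by simp), one_mul]
  exact (hg (2 * p)).mul' (hf (2 * p))

lemma const_mul (hf : HasAllMoments f P) (c : ℝ) : HasAllMoments (fun ω => c * f ω) P :=
  fun p => (hf p).const_mul c

lemma const [IsFiniteMeasure P] (c : ℝ) : HasAllMoments (fun _ => c) P :=
  fun _ => memLp_const c

lemma sub (hf : HasAllMoments f P) (hg : HasAllMoments g P) :
    HasAllMoments (fun ω => f ω - g ω) P := fun p => (hf p).sub (hg p)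

lemma pow [IsFiniteMeasure P] (hf : HasAllMoments f P) (n : ℕ) :
    HasAllMoments (fun ω => f ω ^ n) P := by
  induction n with
  | zero => simpa using const 1
  | succ n ih => simpa only [pow_succ] using ih.mul hf

lemma sum {ι : Type*} {s : Finset ι} {f : ι → Ω → ℝ} (hf : ∀ i ∈ s, HasAllMoments (f i) P) :
    HasAllMoments (fun ω => ∑ i ∈ s, f i ω) P := fun p => memLp_finsetSum s fun i hi => hf i hi p

end HasAllMoments

/-- Nonnegative random variables with summable expectations are almost surely summable. -/
lemma ae_summable_of_summable_integral {f : ℕ → Ω → ℝ} {c : ℕ → ℝ}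
    (hf0 : ∀ n ω, 0 ≤ f n ω) (hf : ∀ n, Integrable (f n) P) (hc : Summable c)
    (hfc : ∀ n, ∫ ω, f n ω ∂P ≤ c n) : ∀ᵐ ω ∂P, Summable fun n => f n ω := by
  have hc0 : ∀ n, 0 ≤ c n := fun n => (integral_nonneg (hf0 n)).trans (hfc n)
  have hm : ∀ n, AEMeasurable (fun ω => ENNReal.ofReal (f n ω)) P :=
    fun n => (hf n).aemeasurable.ennreal_ofReal
  have h1 : ∫⁻ ω, ∑' n, ENNReal.ofReal (f n ω) ∂P ≠ ⊤ := by
    rw [lintegral_tsum hm]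
    refine ne_top_of_le_ne_top (b := ∑' n, ENNReal.ofReal (c n)) ?_
      (ENNReal.tsum_le_tsum fun n => ?_)
    · rw [← ENNReal.ofReal_tsum_of_nonneg hc0 hc]
      exact ENNReal.ofReal_ne_top
    · rw [← ofReal_integral_eq_lintegral_ofReal (hf n) (ae_of_all _ (hf0 n))]
      exact ENNReal.ofReal_le_ofReal (hfc n)
  filter_upwards [ae_lt_top' (AEMeasurable.tsum hm) h1] with ω hω
  have := ENNReal.summable_toReal hω.ne
  simpa only [ENNReal.toReal_ofReal (hf0 _ ω)] using this

lemma integral_sum_pow_four {X : ℕ → Ω → ℝ} [IsProbabilityMeasure P]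
    (hX : ∀ k, HasAllMoments (X k) P)
    (hindep : iIndepFun X P) {v κ : ℝ} (h1 : ∀ k, ∫ ω, X k ω ∂P = 0)
    (h2 : ∀ k, ∫ ω, X k ω ^ 2 ∂P = v) (h4 : ∀ k, ∫ ω, X k ω ^ 4 ∂P = κ) (M : ℕ) :
    ∫ ω, (∑ k ∈ Finset.range M, X k ω) ∂P = 0 ∧
    ∫ ω, (∑ k ∈ Finset.range M, X k ω) ^ 2 ∂P = M * v ∧
    ∫ ω, (∑ k ∈ Finset.range M, X k ω) ^ 4 ∂P = 3 * M * (M - 1) * v ^ 2 + M * κ := by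
  induction M with
  | zero => simp
  | succ M ih =>
    obtain ⟨e1, e2, e4⟩ := ih
    set S : Ω → ℝ := fun ω => ∑ k ∈ Finset.range M, X k ω with hS
    have e2' : ∫ ω, S ω ^ 2 ∂P = M * v := e2
    have e4' : ∫ ω, S ω ^ 4 ∂P = 3 * M * (M - 1) * v ^ 2 + M * κ := e4
    have hSm : HasAllMoments S P := HasAllMoments.sum fun k _ => hX k
    have hI : IndepFun S (X M) P := by
      have := hindep.indepFun_sum_range_succ₀ (fun k => (hX k).integrable.aemeasurable) M
      convert this using 1
      funext ω
      simp [hS]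
    have hmul : ∀ i j : ℕ, ∫ ω, S ω ^ i * X M ω ^ j ∂P =
        (∫ ω, S ω ^ i ∂P) * ∫ ω, X M ω ^ j ∂P := fun i j =>
      hI.integral_fun_comp_mul_comp (f := fun x => x ^ i) (g := fun x => x ^ j)
        hSm.integrable.aemeasurable (hX M).integrable.aemeasurable
        (by fun_prop) (by fun_prop)
    have hint : ∀ i j : ℕ, Integrable (fun ω => S ω ^ i * X M ω ^ j) P := fun i j =>
      ((hSm.pow i).mul ((hX M).pow j)).integrable
    have hs : ∀ ω, ∑ k ∈ Finset.range (M + 1), X k ω = S ω + X M ω := fun ω =>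
      Finset.sum_range_succ _ _
    simp only [hs]
    refine ⟨?_, ?_, ?_⟩
    · rw [integral_add hSm.integrable (hX M).integrable, e1, h1, add_zero]
    · have e : ∀ ω, (S ω + X M ω) ^ 2 =
          S ω ^ 2 * X M ω ^ 0 + 2 * (S ω ^ 1 * X M ω ^ 1) + S ω ^ 0 * X M ω ^ 2 := fun ω => by ring
      simp only [e]
      have i1 : Integrable (fun ω => S ω ^ 2 * X M ω ^ 0 + 2 * (S ω ^ 1 * X M ω ^ 1)) P :=
        (hint 2 0).add ((hint 1 1).const_mul 2)
      rw [integral_add i1 (hint 0 2), integral_add (hint 2 0) ((hint 1 1).const_mul 2),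
        integral_const_mul, hmul, hmul, hmul]
      simp [e1, e2', h1, h2]
      ring
    · have e : ∀ ω, (S ω + X M ω) ^ 4 =
          S ω ^ 4 * X M ω ^ 0 + 4 * (S ω ^ 3 * X M ω ^ 1) + 6 * (S ω ^ 2 * X M ω ^ 2)
            + 4 * (S ω ^ 1 * X M ω ^ 3) + S ω ^ 0 * X M ω ^ 4 := fun ω => by ring
      simp only [e]
      have i1 : Integrable (fun ω => S ω ^ 4 * X M ω ^ 0 + 4 * (S ω ^ 3 * X M ω ^ 1)) P :=
        (hint 4 0).add ((hint 3 1).const_mul 4)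
      have i2 : Integrable (fun ω => S ω ^ 4 * X M ω ^ 0 + 4 * (S ω ^ 3 * X M ω ^ 1) +
          6 * (S ω ^ 2 * X M ω ^ 2)) P := i1.add ((hint 2 2).const_mul 6)
      have i3 : Integrable (fun ω => S ω ^ 4 * X M ω ^ 0 + 4 * (S ω ^ 3 * X M ω ^ 1) +
          6 * (S ω ^ 2 * X M ω ^ 2) + 4 * (S ω ^ 1 * X M ω ^ 3)) P :=
        i2.add ((hint 1 3).const_mul 4)
      rw [integral_add i3 (hint 0 4), integral_add i2 ((hint 1 3).const_mul 4),
        integral_add i1 ((hint 2 2).const_mul 6), integral_add (hint 4 0) ((hint 3 1).const_mul 4),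
        integral_const_mul, integral_const_mul, integral_const_mul, hmul, hmul, hmul, hmul, hmul]
      simp [e1, e2', e4', h1, h2, h4]
      ring

end AllMoments

/-! ### Moments of the noise coefficients -/

section Noise

lemma integral_pow_four_gaussianReal : ∫ x, x ^ 4 ∂(gaussianReal 0 1) = 3 := by
  have h := iteratedDeriv_mgf_zero (X := fun x : ℝ => x) (μ := gaussianReal 0 1) (by simp) 4
  rw [mgf_fun_id_gaussianReal] at h
  have h' : ∫ x, x ^ 4 ∂(gaussianReal 0 1) =
      iteratedDeriv 4 (fun t => Real.exp (0 * t + ((1 : NNReal) : ℝ) * t ^ 2 / 2)) 0 := by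
    rw [h]; rfl
  rw [h']
  simp only [zero_mul, zero_add, NNReal.coe_one, one_mul]
  have hE : ∀ x : ℝ, HasDerivAt (fun t : ℝ => Real.exp (t ^ 2 / 2)) (x * Real.exp (x ^ 2 / 2)) x :=
    fun x => by
      have := (((hasDerivAt_id x).pow 2).div_const 2).exp
      simpa [mul_comm] using this
  have hp : ∀ (p p' : ℝ → ℝ), (∀ x, HasDerivAt p (p' x) x) →
      deriv (fun t => p t * Real.exp (t ^ 2 / 2)) =
        fun t => (p' t + t * p t) * Real.exp (t ^ 2 / 2) := fun p p' hp => by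
    funext x
    refine HasDerivAt.deriv (((hp x).mul (hE x)).congr_deriv ?_)
    ring
  have d1 : deriv (fun t : ℝ => Real.exp (t ^ 2 / 2)) = fun t => t * Real.exp (t ^ 2 / 2) :=
    funext fun x => (hE x).deriv
  have d2 := hp (fun t => t) (fun _ => 1) hasDerivAt_id
  have d3 := hp (fun t => 1 + t * t) (fun t => 2 * t) fun x => by
    have := ((hasDerivAt_id x).mul (hasDerivAt_id x)).const_add 1
    refine this.congr_deriv ?_
    simp; ring
  have d4 := hp (fun t => 2 * t + t * (1 + t * t)) (fun t => 3 + 3 * t ^ 2) fun x => by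
    have h0 := hasDerivAt_id x
    refine ((h0.const_mul 2).add (h0.mul ((h0.mul h0).const_add 1))).congr_deriv ?_
    simp; ring
  rw [iteratedDeriv_succ, iteratedDeriv_succ, iteratedDeriv_succ, iteratedDeriv_one, d1, d2, d3, d4]
  simp

variable {Ω : Type*} [MeasurableSpace Ω] {P : Measure Ω} {ξ : ℕ → Ω → ℝ}

lemma hasAllMoments_of_hasLaw_gaussianReal {X : Ω → ℝ} (hX : HasLaw X (gaussianReal 0 1) P) :
    HasAllMoments X P := fun p => by
  have h := memLp_id_gaussianReal' (μ := 0) (v := 1) (p : ENNReal) (by simp)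
  rw [← hX.map_eq] at h
  exact (memLp_map_measure_iff (by fun_prop) hX.aemeasurable).1 h

lemma integral_pow_of_hasLaw {X : Ω → ℝ} {μ : Measure ℝ} (hX : HasLaw X μ P) (n : ℕ) :
    ∫ ω, X ω ^ n ∂P = ∫ x, x ^ n ∂μ := by
  rw [← hX.map_eq, integral_map hX.aemeasurable (by fun_prop)]

lemma integral_gaussian_one {X : Ω → ℝ} (hX : HasLaw X (gaussianReal 0 1) P) :
    ∫ ω, X ω ∂P = 0 := by
  have := integral_pow_of_hasLaw hX 1
  simpa using this

lemma integral_gaussian_sq {X : Ω → ℝ} (hX : HasLaw X (gaussianReal 0 1) P) :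
    ∫ ω, X ω ^ 2 ∂P = 1 := by
  rw [integral_pow_of_hasLaw hX]
  have h := variance_fun_id_gaussianReal (μ := 0) (v := 1)
  rw [variance_eq_integral (by fun_prop)] at h
  simpa using h

lemma hasAllMoments_blockFiber (hlaw : ∀ k, HasLaw (ξ k) (gaussianReal 0 1) P)
    (F : Finset (ℕ × ℕ)) :
    HasAllMoments (fun ω => ∑ p ∈ F, ξ p.1 ω / (p.1 + 1) * (ξ p.2 ω / (p.2 + 1))) P := by
  have m := fun i => hasAllMoments_of_hasLaw_gaussianReal (hlaw i)
  refine HasAllMoments.sum fun p _ => ?_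
  convert ((m p.1).mul (m p.2)).const_mul (1 / (p.1 + 1 : ℝ) * (1 / (p.2 + 1 : ℝ))) using 2
  ring

lemma integral_sq_mul_sq (hlaw : ∀ k, HasLaw (ξ k) (gaussianReal 0 1) P)
    (hindep : iIndepFun ξ P) {i j : ℕ} (hij : i ≠ j) :
    ∫ ω, ξ i ω ^ 2 * ξ j ω ^ 2 ∂P = 1 := by
  rw [(hindep.indepFun hij).integral_fun_comp_mul_comp (f := fun x => x ^ 2) (g := fun x => x ^ 2)
    (hlaw i).aemeasurable (hlaw j).aemeasurable (by fun_prop) (by fun_prop),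
    integral_gaussian_sq (hlaw i), integral_gaussian_sq (hlaw j), one_mul]

lemma integrable_blockBound (hlaw : ∀ k, HasLaw (ξ k) (gaussianReal 0 1) P) (n : ℕ) :
    Integrable (fun ω => blockBound (fun k => ξ k ω) n) P :=
  integrable_finsetSum _ fun _ _ => (hasAllMoments_blockFiber hlaw _).integrable.abs

lemma integral_mul_three_eq_zero (hlaw : ∀ k, HasLaw (ξ k) (gaussianReal 0 1) P)
    (hindep : iIndepFun ξ P) {i j k l : ℕ} (hj : i ≠ j) (hk : i ≠ k) (hl : i ≠ l) :
    ∫ ω, ξ i ω * (ξ j ω * ξ k ω * ξ l ω) ∂P = 0 := by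
  have h := hindep.indepFun_finset₀ {i} {j, k, l} (by simp [hj, hk, hl])
    (fun i => (hlaw i).aemeasurable)
  have h2 : IndepFun (ξ i) (fun ω => ξ j ω * ξ k ω * ξ l ω) P := by
    have hφ : Measurable fun x : ({i} : Finset ℕ) → ℝ => x ⟨i, by simp⟩ := measurable_pi_apply _
    have hψ : Measurable fun x : ({j, k, l} : Finset ℕ) → ℝ =>
        x ⟨j, by simp⟩ * x ⟨k, by simp⟩ * x ⟨l, by simp⟩ := by fun_prop
    exact h.comp hφ hψ
  have m := fun i => hasAllMoments_of_hasLaw_gaussianReal (hlaw i)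
  have := h2.integral_fun_mul_eq_mul_integral (m i).integrable.aestronglyMeasurable
    (((m j).mul (m k)).mul (m l)).integrable.aestronglyMeasurable
  refine this.trans ?_
  have e : ∫ ω, ξ i ω ∂P = 0 := integral_gaussian_one (hlaw i)
  exact mul_eq_zero_of_left e _

/-- Products of pairs at the same nonzero distance are uncorrelated. -/
lemma integral_pair_mul_pair_eq_zero (hlaw : ∀ k, HasLaw (ξ k) (gaussianReal 0 1) P)
    (hindep : iIndepFun ξ P) {p q : ℕ × ℕ} {d : ℤ} (hd : d ≠ 0) (hp : (p.1 : ℤ) - p.2 = d)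
    (hq : (q.1 : ℤ) - q.2 = d) (hpq : p ≠ q) :
    ∫ ω, ξ p.1 ω * ξ p.2 ω * (ξ q.1 ω * ξ q.2 ω) ∂P = 0 := by
  obtain ⟨p1, p2⟩ := p
  obtain ⟨q1, q2⟩ := q
  simp only at hp hq ⊢
  have hne : p1 ≠ q1 := by
    rintro rfl
    exact hpq (by simp; omega)
  have h1 : p1 ≠ p2 := by omega
  have h2 : q1 ≠ q2 := by omega
  have h3 : p2 ≠ q2 := by omega
  rcases eq_or_ne p1 q2 with h | h
  · have h5 : q1 ≠ p2 := by omega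
    rw [← integral_mul_three_eq_zero hlaw hindep hne.symm h5 h2]
    congr 1
    funext ω
    ring
  · rw [← integral_mul_three_eq_zero hlaw hindep h1 hne h]
    congr 1
    funext ω
    ring

lemma integral_sq_sum_pairs (hlaw : ∀ k, HasLaw (ξ k) (gaussianReal 0 1) P)
    (hindep : iIndepFun ξ P) {d : ℤ} (hd : d ≠ 0) (F : Finset (ℕ × ℕ))
    (hF : ∀ p ∈ F, (p.1 : ℤ) - p.2 = d) (w : ℕ × ℕ → ℝ) :
    ∫ ω, (∑ p ∈ F, w p * (ξ p.1 ω * ξ p.2 ω)) ^ 2 ∂P = ∑ p ∈ F, w p ^ 2 := by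
  have m := fun i => hasAllMoments_of_hasLaw_gaussianReal (hlaw i)
  have e : ∀ ω, (∑ p ∈ F, w p * (ξ p.1 ω * ξ p.2 ω)) ^ 2 = ∑ p ∈ F, ∑ q ∈ F,
      w p * w q * (ξ p.1 ω * ξ p.2 ω * (ξ q.1 ω * ξ q.2 ω)) := fun ω => by
    rw [sq, Finset.sum_mul_sum]
    exact Finset.sum_congr rfl fun p _ => Finset.sum_congr rfl fun q _ => by ring
  have hm : ∀ p q : ℕ × ℕ, HasAllMoments
      (fun ω => w p * w q * (ξ p.1 ω * ξ p.2 ω * (ξ q.1 ω * ξ q.2 ω))) P := fun p q =>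
    (((m _).mul (m _)).mul ((m _).mul (m _))).const_mul _
  simp only [e]
  rw [integral_finsetSum _ fun p _ => (HasAllMoments.sum fun q _ => hm p q).integrable]
  refine Finset.sum_congr rfl fun p hp => ?_
  rw [integral_finsetSum _ fun q _ => (hm p q).integrable, Finset.sum_eq_single p]
  · rw [integral_const_mul]
    have hne : p.1 ≠ p.2 := by have := hF p hp; omega
    have : ∫ ω, ξ p.1 ω * ξ p.2 ω * (ξ p.1 ω * ξ p.2 ω) ∂P = 1 := by
      rw [← integral_sq_mul_sq hlaw hindep hne]
      congr 1
      funext ω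
      ring
    rw [this]
    ring
  · intro q hq hqp
    rw [integral_const_mul,
      integral_pair_mul_pair_eq_zero hlaw hindep hd (hF p hp) (hF q hq) hqp.symm,
      mul_zero]
  · exact fun h => absurd hp h

variable [IsProbabilityMeasure P]

lemma integral_abs_le_of_integral_sq_le {f : Ω → ℝ} (hf : HasAllMoments f P) {s : ℝ} (hs : 0 < s)
    (h : ∫ ω, f ω ^ 2 ∂P ≤ s ^ 2) : ∫ ω, |f ω| ∂P ≤ s := by
  have h1 : ∫ ω, |f ω| ∂P ≤ ∫ ω, (1 / (2 * s) * f ω ^ 2 + s / 2) ∂P := by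
    refine integral_mono hf.integrable.abs
      (((hf.pow 2).integrable.const_mul _).add (integrable_const _)) fun ω => ?_
    have h0 : 0 ≤ (|f ω| - s) ^ 2 / (2 * s) := by positivity
    have : 1 / (2 * s) * f ω ^ 2 + s / 2 - |f ω| = (|f ω| - s) ^ 2 / (2 * s) := by
      rw [← sq_abs (f ω)]
      field_simp
      ring
    simp only
    linarith
  refine h1.trans ?_
  rw [integral_add ((hf.pow 2).integrable.const_mul _) (integrable_const _), integral_const_mul]
  simp only [integral_const, probReal_univ, one_smul]
  calc 1 / (2 * s) * ∫ ω, f ω ^ 2 ∂P + s / 2 ≤ 1 / (2 * s) * s ^ 2 + s / 2 := by gcongr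
    _ = s := by field_simp; norm_num

lemma integral_abs_blockFiber_le (hlaw : ∀ k, HasLaw (ξ k) (gaussianReal 0 1) P)
    (hindep : iIndepFun ξ P) (n : ℕ) {d : ℤ} (hd : d ≠ 0) :
    ∫ ω, |∑ p ∈ ((Finset.Ico (2 ^ n) (2 ^ (n + 1))) ×ˢ (Finset.Ico (2 ^ n) (2 ^ (n + 1)))).filter
      (fun p : ℕ × ℕ => (p.1 : ℤ) - p.2 = d), ξ p.1 ω / (p.1 + 1) * (ξ p.2 ω / (p.2 + 1))| ∂P ≤
      ((√2 ^ n) ^ 3)⁻¹ := by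
  refine integral_abs_le_of_integral_sq_le (hasAllMoments_blockFiber hlaw _) (by positivity) ?_
  set F := ((Finset.Ico (2 ^ n) (2 ^ (n + 1))) ×ˢ (Finset.Ico (2 ^ n) (2 ^ (n + 1)))).filter
      (fun p : ℕ × ℕ => (p.1 : ℤ) - p.2 = d) with hF
  have h := integral_sq_sum_pairs hlaw hindep hd F (fun p hp => (Finset.mem_filter.1 hp).2)
    (fun p => 1 / (p.1 + 1 : ℝ) * (1 / (p.2 + 1 : ℝ)))
  have e : ∀ ω, ∑ p ∈ F, ξ p.1 ω / (p.1 + 1) * (ξ p.2 ω / (p.2 + 1)) =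
      ∑ p ∈ F, 1 / (p.1 + 1 : ℝ) * (1 / (p.2 + 1 : ℝ)) * (ξ p.1 ω * ξ p.2 ω) := fun ω =>
    Finset.sum_congr rfl fun p _ => by ring
  simp only [e]
  rw [h]
  have hcard : F.card ≤ 2 ^ n := by
    have : F.card ≤ (Finset.Ico (2 ^ n) (2 ^ (n + 1))).card := by
      refine Finset.card_le_card_of_injOn Prod.fst (fun p hp => ?_) fun p hp q hq hpq => ?_
      · exact (Finset.mem_product.1 (Finset.mem_filter.1 hp).1).1
      · have h1 := (Finset.mem_filter.1 hp).2
        have h2 := (Finset.mem_filter.1 hq).2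
        ext
        · exact hpq
        · omega
    simpa [pow_succ, mul_two] using this
  have hterm : ∀ p ∈ F, (1 / (p.1 + 1 : ℝ) * (1 / (p.2 + 1 : ℝ))) ^ 2 ≤ ((2 ^ n : ℝ) ^ 4)⁻¹ := by
    intro p hp
    have hp' := Finset.mem_product.1 (Finset.mem_filter.1 hp).1
    have h1 : (2 ^ n : ℝ) ≤ p.1 + 1 := by
      have : 2 ^ n ≤ p.1 := (Finset.mem_Ico.1 hp'.1).1
      have : (2 ^ n : ℝ) ≤ p.1 := by exact_mod_cast this
      linarith
    have h2 : (2 ^ n : ℝ) ≤ p.2 + 1 := by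
      have : 2 ^ n ≤ p.2 := (Finset.mem_Ico.1 hp'.2).1
      have : (2 ^ n : ℝ) ≤ p.2 := by exact_mod_cast this
      linarith
    calc (1 / (p.1 + 1 : ℝ) * (1 / (p.2 + 1 : ℝ))) ^ 2
        ≤ (1 / (2 ^ n : ℝ) * (1 / (2 ^ n : ℝ))) ^ 2 := by gcongr
      _ = _ := by field_simp
  refine (Finset.sum_le_card_nsmul _ _ _ hterm).trans ?_
  have hs : (√2 ^ n) ^ 2 = (2 ^ n : ℝ) := by
    rw [← pow_mul, mul_comm, pow_mul, Real.sq_sqrt (by norm_num)]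
  rw [nsmul_eq_mul]
  calc (F.card : ℝ) * ((2 ^ n : ℝ) ^ 4)⁻¹ ≤ (2 ^ n : ℝ) * ((2 ^ n : ℝ) ^ 4)⁻¹ := by
        gcongr
        exact_mod_cast hcard
    _ = (((√2 ^ n) ^ 3)⁻¹) ^ 2 := by
        rw [inv_pow, pow_right_comm _ 3 2, hs]
        field_simp

lemma integral_abs_blockFiber_zero_le (hlaw : ∀ k, HasLaw (ξ k) (gaussianReal 0 1) P) (n : ℕ) :
    ∫ ω, |∑ p ∈ ((Finset.Ico (2 ^ n) (2 ^ (n + 1))) ×ˢ (Finset.Ico (2 ^ n) (2 ^ (n + 1)))).filter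
      (fun p : ℕ × ℕ => (p.1 : ℤ) - p.2 = 0), ξ p.1 ω / (p.1 + 1) * (ξ p.2 ω / (p.2 + 1))| ∂P ≤
      ((√2 ^ n) ^ 2)⁻¹ := by
  have m := fun i => hasAllMoments_of_hasLaw_gaussianReal (hlaw i)
  have e : ∀ ω, |∑ p ∈ ((Finset.Ico (2 ^ n) (2 ^ (n + 1))) ×ˢ
      (Finset.Ico (2 ^ n) (2 ^ (n + 1)))).filter
      (fun p : ℕ × ℕ => (p.1 : ℤ) - p.2 = 0), ξ p.1 ω / (p.1 + 1) * (ξ p.2 ω / (p.2 + 1))| =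
      ∑ k ∈ (Finset.Ico (2 ^ n) (2 ^ (n + 1)) : Finset ℕ), 1 / (k + 1 : ℝ) ^ 2 * ξ k ω ^ 2 :=
    fun ω => by
    have : ∑ p ∈ ((Finset.Ico (2 ^ n) (2 ^ (n + 1))) ×ˢ
      (Finset.Ico (2 ^ n) (2 ^ (n + 1)))).filter
      (fun p : ℕ × ℕ => (p.1 : ℤ) - p.2 = 0), ξ p.1 ω / (p.1 + 1) * (ξ p.2 ω / (p.2 + 1)) =
      ∑ k ∈ (Finset.Ico (2 ^ n) (2 ^ (n + 1)) : Finset ℕ), 1 / (k + 1 : ℝ) ^ 2 * ξ k ω ^ 2 := by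
      rw [Finset.sum_filter, Finset.sum_product]
      refine Finset.sum_congr rfl fun k hk => ?_
      rw [Finset.sum_eq_single k]
      · simp only [sub_self, if_true]
        field_simp
      · intro l _ hl
        exact if_neg (by simp only; omega)
      · exact fun h => absurd hk h
    rw [this, abs_of_nonneg (Finset.sum_nonneg fun k _ => by positivity)]
  simp only [e]
  rw [integral_finsetSum _ fun k _ => (((m k).pow 2).const_mul _).integrable]
  have hterm : ∀ k ∈ (Finset.Ico (2 ^ n) (2 ^ (n + 1)) : Finset ℕ),
      ∫ ω, 1 / (k + 1 : ℝ) ^ 2 * ξ k ω ^ 2 ∂P ≤ ((2 ^ n : ℝ) ^ 2)⁻¹ := fun k hk => by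
    rw [integral_const_mul, integral_gaussian_sq (hlaw k), mul_one, one_div]
    have : 2 ^ n ≤ k := (Finset.mem_Ico.1 hk).1
    have : (2 ^ n : ℝ) ≤ k := by exact_mod_cast this
    gcongr
    linarith
  refine (Finset.sum_le_card_nsmul _ _ _ hterm).trans_eq ?_
  have hs : (√2 ^ n) ^ 2 = (2 ^ n : ℝ) := by
    rw [← pow_mul, mul_comm, pow_mul, Real.sq_sqrt (by norm_num)]
  have hc : (Finset.Ico (2 ^ n) (2 ^ (n + 1))).card = 2 ^ n := by simp [pow_succ, mul_two]
  rw [hs, hc, nsmul_eq_mul]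
  push_cast
  field_simp

lemma integral_blockBound_le (hlaw : ∀ k, HasLaw (ξ k) (gaussianReal 0 1) P)
    (hindep : iIndepFun ξ P) (n : ℕ) :
    ∫ ω, blockBound (fun k => ξ k ω) n ∂P ≤ 3 * (√2 ^ n)⁻¹ := by
  unfold blockBound
  rw [integral_finsetSum _ fun _ _ => (hasAllMoments_blockFiber hlaw _).integrable.abs]
  set s := √2 ^ n with hsd
  have hs1 : 1 ≤ s := one_le_pow₀ (Real.one_le_sqrt.2 (by norm_num))
  have hs : s ^ 2 = (2 ^ n : ℝ) := by
    rw [hsd, ← pow_mul, mul_comm, pow_mul, Real.sq_sqrt (by norm_num)]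
  have hterm : ∀ d ∈ Finset.Ioo (-(2 ^ n : ℤ)) (2 ^ n),
      ∫ ω, |∑ p ∈ ((Finset.Ico (2 ^ n) (2 ^ (n + 1))) ×ˢ
        (Finset.Ico (2 ^ n) (2 ^ (n + 1)))).filter
        (fun p : ℕ × ℕ => (p.1 : ℤ) - p.2 = d),
          ξ p.1 ω / (p.1 + 1) * (ξ p.2 ω / (p.2 + 1))| ∂P ≤
      (s ^ 3)⁻¹ + if d = 0 then (s ^ 2)⁻¹ else 0 := fun d _ => by
    split_ifs with hd
    · subst hd
      exact (integral_abs_blockFiber_zero_le hlaw n).trans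
        (le_add_of_nonneg_left (by positivity))
    · rw [add_zero]
      exact integral_abs_blockFiber_le hlaw hindep n hd
  refine (Finset.sum_le_sum hterm).trans ?_
  rw [Finset.sum_add_distrib, Finset.sum_const, Finset.sum_ite_eq', nsmul_eq_mul]
  have hcard : ((Finset.Ioo (-(2 ^ n : ℤ)) (2 ^ n)).card : ℝ) ≤ 2 * s ^ 2 := by
    rw [hs, Int.card_Ioo]
    have : ((2 ^ n - -(2 ^ n) - 1 : ℤ).toNat : ℤ) ≤ 2 * 2 ^ n := by
      have : (0 : ℤ) < 2 ^ n := by positivity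
      omega
    exact_mod_cast this
  have h0 : (if (0 : ℤ) ∈ Finset.Ioo (-(2 ^ n : ℤ)) (2 ^ n) then (s ^ 2)⁻¹ else 0) ≤ s⁻¹ := by
    have hle : (s ^ 2)⁻¹ ≤ s⁻¹ := inv_anti₀ (by positivity) (by nlinarith)
    split_ifs
    · exact hle
    · positivity
  calc _ ≤ 2 * s ^ 2 * (s ^ 3)⁻¹ + s⁻¹ := by gcongr
    _ = 3 * s⁻¹ := by field_simp; norm_num

lemma ae_summable_sqrt_blockBound (hlaw : ∀ k, HasLaw (ξ k) (gaussianReal 0 1) P)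
    (hindep : iIndepFun ξ P) :
    ∀ᵐ ω ∂P, Summable fun n => √(blockBound (fun k => ξ k ω) n) := by
  have h2 : (6 / 5 : ℝ) < √2 := by
    rw [Real.lt_sqrt (by norm_num)]; norm_num
  have hsum : Summable fun n : ℕ => 3 * ((6 / 5 : ℝ) / √2) ^ n :=
    (summable_geometric_of_lt_one (by positivity)
      ((div_lt_one (by positivity)).2 h2)).mul_left 3
  have h := ae_summable_of_summable_integral (P := P)
    (f := fun n ω => (6 / 5 : ℝ) ^ n * blockBound (fun k => ξ k ω) n)
    (fun n ω => mul_nonneg (by positivity) (blockBound_nonneg _ _))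
    (fun n => (integrable_blockBound hlaw n).const_mul _) hsum (fun n => by
      rw [integral_const_mul]
      calc (6 / 5 : ℝ) ^ n * ∫ ω, blockBound (fun k => ξ k ω) n ∂P
          ≤ (6 / 5 : ℝ) ^ n * (3 * (√2 ^ n)⁻¹) := by
            gcongr; exact integral_blockBound_le hlaw hindep n
        _ = 3 * ((6 / 5 : ℝ) / √2) ^ n := by rw [div_pow (6 / 5 : ℝ)]; ring)
  filter_upwards [h] with ω hω
  have hg : Summable fun n : ℕ => (5 / 6 : ℝ) ^ n :=
    summable_geometric_of_lt_one (by norm_num) (by norm_num)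
  refine Summable.of_nonneg_of_le (fun n => Real.sqrt_nonneg _) (fun n => ?_) (hω.add hg)
  set r := √(blockBound (fun k => ξ k ω) n) with hr
  have hr2 : blockBound (fun k => ξ k ω) n = r ^ 2 := (Real.sq_sqrt (blockBound_nonneg _ _)).symm
  rw [hr2]
  set u := (6 / 5 : ℝ) ^ n with hu
  have hu0 : 0 < u := by positivity
  have hv : (5 / 6 : ℝ) ^ n = u⁻¹ := by rw [hu, ← inv_pow]; norm_num
  rw [hv]
  have h0 : 0 ≤ (u * r - 1) ^ 2 / u := by positivity
  have e : (u * r - 1) ^ 2 / u = u * r ^ 2 + u⁻¹ - 2 * r := by field_simp; ring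
  have : 0 ≤ r := Real.sqrt_nonneg _
  linarith

lemma ae_summable_abs_div_sq (hlaw : ∀ k, HasLaw (ξ k) (gaussianReal 0 1) P) :
    ∀ᵐ ω ∂P, Summable fun k : ℕ => |ξ k ω| / (k + 1 : ℝ) ^ 2 := by
  have m := fun i => hasAllMoments_of_hasLaw_gaussianReal (hlaw i)
  have hsum : Summable fun k : ℕ => 1 / (k + 1 : ℝ) ^ 2 := by
    have := (summable_nat_add_iff 1).2 (Real.summable_one_div_nat_pow.2 (by norm_num : 1 < 2))
    simpa using this
  refine ae_summable_of_summable_integral (fun k ω => by positivity)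
    (fun k => (m k).integrable.abs.div_const _) hsum fun k => ?_
  rw [integral_div]
  gcongr
  exact integral_abs_le_of_integral_sq_le (m k) one_pos
    (by rw [integral_gaussian_sq (hlaw k)]; simp)

end Noise

/-! ### The covariance of the cosine series -/

lemma hasSum_cos_div_sq {u : ℝ} (hu0 : 0 ≤ u) (hu : u ≤ 2 * Real.pi) :
    HasSum (fun k : ℕ => Real.cos ((k + 1 : ℝ) * u) / (k + 1 : ℝ) ^ 2)
      (Real.pi ^ 2 / 6 - Real.pi * u / 2 + u ^ 2 / 4) := by
  have hpi := Real.pi_pos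
  have h := hasSum_one_div_nat_pow_mul_cos (k := 1) one_ne_zero (x := u / (2 * Real.pi))
    ⟨by positivity, (div_le_one (by positivity)).2 hu⟩
  have h1 := (hasSum_nat_add_iff' 1).2 h
  have hb : (Polynomial.map (algebraMap ℚ ℝ) (Polynomial.bernoulli (2 * 1))).eval
      (u / (2 * Real.pi)) = (u / (2 * Real.pi)) ^ 2 - u / (2 * Real.pi) + 1 / 6 := by
    simp [Polynomial.bernoulli, Finset.sum_range_succ, _root_.bernoulli, bernoulli'_two]
    ring
  rw [hb] at h1
  convert! h1 using 1
  · funext k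
    push_cast
    rw [show 2 * Real.pi * ((k : ℝ) + 1) * (u / (2 * Real.pi)) = (k + 1 : ℝ) * u by field_simp]
    ring
  · simp
    field_simp
    ring

lemma hasSum_cosMode_mul_cosMode {x y : ℝ} (hx : x ∈ Icc 0 Real.pi) (hy : y ∈ Icc 0 Real.pi) :
    HasSum (fun k : ℕ => cosMode k x * cosMode k y)
      (Real.pi / 3 - max x y + (x ^ 2 + y ^ 2) / (2 * Real.pi)) := by
  wlog hxy : x ≤ y generalizing x y
  · have := this hy hx (le_of_not_ge hxy)
    rw [max_comm, add_comm (x ^ 2)]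
    simpa only [mul_comm] using this
  have hpi := Real.pi_pos
  have h1 := hasSum_cos_div_sq (u := y - x) (by linarith) (by linarith [hx.1, hy.2])
  have h2 := hasSum_cos_div_sq (u := y + x) (by linarith [hx.1, hy.1]) (by linarith [hx.2, hy.2])
  have h3 := (h1.add h2).mul_left (1 / Real.pi)
  rw [max_eq_right hxy]
  convert! h3 using 1
  · funext k
    unfold cosMode
    have hs : √(2 / Real.pi) * √(2 / Real.pi) = 2 / Real.pi :=
      Real.mul_self_sqrt (by positivity)
    rw [mul_sub, mul_add _ y x, Real.cos_sub, Real.cos_add]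
    calc _ = √(2 / Real.pi) * √(2 / Real.pi) * (Real.cos ((k + 1 : ℝ) * x) *
          Real.cos ((k + 1 : ℝ) * y) / (k + 1 : ℝ) ^ 2) := by field_simp
      _ = _ := by rw [hs]; field_simp; ring
  · field_simp
    ring

lemma hasSum_cosMode_increments {a b : ℝ} (ha : 0 ≤ a) (hab : a ≤ b) (hb : b ≤ Real.pi)
    {M i j : ℕ} (hi : i < M) (hj : j < M) :
    HasSum (fun k => (cosMode k (gridPoint a b M (i + 1)) - cosMode k (gridPoint a b M i)) *
      (cosMode k (gridPoint a b M (j + 1)) - cosMode k (gridPoint a b M j)))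
      (if i = j then (b - a) / M else 0) := by
  wlog hij : i ≤ j generalizing i j
  · have := this hj hi (le_of_not_ge hij)
    simpa only [mul_comm, eq_comm] using this
  have hmem : ∀ i ≤ M, gridPoint a b M i ∈ Icc 0 Real.pi := fun i hi =>
    Icc_subset_Icc ha hb (gridPoint_mem_Icc hab hi)
  have hmono : Monotone (gridPoint a b M) := monotone_nat_of_le_succ fun n => by
    have h1 := gridPoint_succ_sub a b M n
    have h2 : 0 ≤ (b - a) / M := div_nonneg (sub_nonneg.2 hab) (Nat.cast_nonneg M)
    linarith
  have hs := gridPoint_succ_sub a b M i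
  have h := (((hasSum_cosMode_mul_cosMode (hmem (i + 1) hi) (hmem (j + 1) hj)).sub
    (hasSum_cosMode_mul_cosMode (hmem (i + 1) hi) (hmem _ hj.le))).sub
    (hasSum_cosMode_mul_cosMode (hmem _ hi.le) (hmem (j + 1) hj))).add
    (hasSum_cosMode_mul_cosMode (hmem _ hi.le) (hmem _ hj.le))
  convert! h using 1
  · funext k
    ring
  · rw [max_eq_right (hmono (by omega : i + 1 ≤ j + 1)),
      max_eq_right (hmono (by omega : i ≤ j + 1)),
      max_eq_right (hmono hij)]
    split_ifs with he
    · subst he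
      rw [max_eq_left (hmono (by omega : i ≤ i + 1)), ← hs]
      ring
    · rw [max_eq_right (hmono (by omega : i + 1 ≤ j))]
      ring

lemma hasSum_sq_sum_cosMode_increments {a b : ℝ} (ha : 0 ≤ a) (hab : a ≤ b) (hb : b ≤ Real.pi)
    {M : ℕ} (c : Fin M → ℝ) :
    HasSum (fun k => (∑ j : Fin M, c j * (cosMode k (gridPoint a b M (j + 1)) -
      cosMode k (gridPoint a b M j))) ^ 2) ((b - a) / M * ∑ j, c j ^ 2) := by
  have h : HasSum (fun k => ∑ i : Fin M, ∑ j : Fin M, c i * c j *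
      ((cosMode k (gridPoint a b M (i + 1)) - cosMode k (gridPoint a b M i)) *
      (cosMode k (gridPoint a b M (j + 1)) - cosMode k (gridPoint a b M j))))
      (∑ i : Fin M, ∑ j : Fin M, c i * c j * if (i : ℕ) = j then (b - a) / M else 0) :=
    hasSum_sum fun i _ => hasSum_sum fun j _ =>
      (hasSum_cosMode_increments ha hab hb i.2 j.2).mul_left _
  convert! h using 1
  · funext k
    rw [sq, Finset.sum_mul_sum]
    exact Finset.sum_congr rfl fun i _ => Finset.sum_congr rfl fun j _ => by ring
  · rw [Finset.mul_sum]
    refine Finset.sum_congr rfl fun i _ => ?_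
    rw [Finset.sum_eq_single i]
    · simp; ring
    · intro j _ hji
      rw [if_neg (fun h => hji (Fin.ext h).symm), mul_zero]
    · simp

/-! ### Laws of Gaussian series -/

section Law

variable {Ω : Type*} [MeasurableSpace Ω] {P : Measure Ω} {ξ : ℕ → Ω → ℝ}

lemma charFun_gaussian_sum (hlaw : ∀ k, HasLaw (ξ k) (gaussianReal 0 1) P)
    (hindep : iIndepFun ξ P) (w : ℕ → ℝ) (s : Finset ℕ) (t : ℝ) :
    charFun (P.map fun ω => ∑ k ∈ s, w k * ξ k ω) t =
      Complex.exp (-((∑ k ∈ s, w k ^ 2 : ℝ) * t ^ 2 / 2)) := by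
  have hm : ∀ k, AEMeasurable (fun ω => w k * ξ k ω) P := fun k =>
    (hlaw k).aemeasurable.const_mul _
  have hi : iIndepFun (fun k ω => w k * ξ k ω) P :=
    hindep.comp (fun k x => w k * x) fun k => by fun_prop
  rw [(hi.restrict s).charFun_map_fun_finsetSum_eq_prod fun k _ => hm k, Finset.prod_apply]
  have e : ∀ k ∈ s, charFun (P.map fun ω => w k * ξ k ω) t =
      Complex.exp (-((w k ^ 2 : ℝ) * t ^ 2 / 2)) := fun k _ => by
    rw [charFun_map_mul_comp (hlaw k).aemeasurable, (hlaw k).map_eq, charFun_gaussianReal]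
    congr 1
    push_cast
    simp
    ring
  rw [Finset.prod_congr rfl e, ← Complex.exp_sum]
  congr 1
  push_cast
  rw [Finset.sum_mul, Finset.sum_div, Finset.sum_neg_distrib]

variable [IsProbabilityMeasure P]

/-- An almost surely convergent Gaussian series is Gaussian. -/
lemma map_eq_gaussianReal_of_ae_tendsto (hlaw : ∀ k, HasLaw (ξ k) (gaussianReal 0 1) P)
    (hindep : iIndepFun ξ P) {w : ℕ → ℝ} {s : ℝ} (hs : HasSum (fun k => w k ^ 2) s) {Y : Ω → ℝ}
    (hY : ∀ᵐ ω ∂P, Tendsto (fun n => ∑ k ∈ Finset.range (2 ^ n), w k * ξ k ω) atTop (𝓝 (Y ω))) :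
    AEMeasurable Y P ∧ P.map Y = gaussianReal 0 s.toNNReal := by
  have hs0 : 0 ≤ s := hs.nonneg fun k => sq_nonneg _
  have hm : ∀ n : ℕ, AEMeasurable (fun ω => ∑ k ∈ Finset.range (2 ^ n), w k * ξ k ω) P := fun n =>
    Finset.aemeasurable_fun_sum _ fun k _ => (hlaw k).aemeasurable.const_mul _
  have hYm : AEMeasurable Y P := aemeasurable_of_tendsto_metrizable_ae' hm hY
  refine ⟨hYm, ?_⟩
  have hprob : IsProbabilityMeasure (P.map Y) := Measure.isProbabilityMeasure_map hYm
  have hT := ProbabilityMeasure.tendsto_iff_tendsto_charFun.1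
    (tendstoInDistribution_of_ae_tendsto hm hYm hY).tendsto
  refine Measure.ext_of_charFun (funext fun t => ?_)
  refine tendsto_nhds_unique (hT t) ?_
  simp only [ProbabilityMeasure.coe_mk, charFun_gaussian_sum hlaw hindep]
  rw [charFun_gaussianReal]
  have hpow : Tendsto (fun n : ℕ => 2 ^ n) atTop atTop :=
    tendsto_pow_atTop_atTop_of_one_lt (by norm_num)
  have h1 : Tendsto (fun n => ((∑ k ∈ Finset.range (2 ^ n), w k ^ 2 : ℝ) : ℂ)) atTop (𝓝 (s : ℂ)) :=
    (Complex.continuous_ofReal.tendsto s).comp (hs.tendsto_sum_nat.comp hpow)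
  have h2 := (((h1.mul_const ((t : ℂ) ^ 2)).div_const 2).neg).cexp
  convert! h2 using 2
  rw [Real.coe_toNNReal _ hs0]
  simp

/-- The law of a random vector is determined by the laws of its linear combinations. -/
lemma map_eq_of_forall_map_sum_eq {ι : Type*} [Fintype ι] {X Y : Ω → ι → ℝ}
    (hX : AEMeasurable X P) (hY : AEMeasurable Y P)
    (h : ∀ c : ι → ℝ, P.map (fun ω => ∑ j, c j * X ω j) = P.map (fun ω => ∑ j, c j * Y ω j)) :
    P.map X = P.map Y := by
  classical
  have : IsProbabilityMeasure (P.map X) := Measure.isProbabilityMeasure_map hX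
  have : IsProbabilityMeasure (P.map Y) := Measure.isProbabilityMeasure_map hY
  refine Measure.ext_of_charFunDual (funext fun L => ?_)
  have hL : ∀ x : ι → ℝ, L x = ∑ j, L (Pi.single j 1) * x j := fun x => by
    conv_lhs => rw [← Finset.univ_sum_single x, map_sum]
    refine Finset.sum_congr rfl fun j _ => ?_
    rw [← mul_one (x j), ← smul_eq_mul, Pi.single_smul, map_smul]
    simp [mul_comm]
  rw [charFunDual_eq_charFun_map_one, charFunDual_eq_charFun_map_one,
    AEMeasurable.map_map_of_aemeasurable (by fun_prop) hX,
    AEMeasurable.map_map_of_aemeasurable (by fun_prop) hY]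
  have e := h fun j => L (Pi.single j 1)
  simp only [← hL] at e
  exact congrArg (fun μ => charFun μ 1) e

lemma ae_tendsto_dyadicSum (hlaw : ∀ k, HasLaw (ξ k) (gaussianReal 0 1) P)
    (hindep : iIndepFun ξ P) : ∀ᵐ ω ∂P, ∀ x, Tendsto (fun n => dyadicSum (fun k => ξ k ω) n x) atTop
      (𝓝 (cosSeries (fun k => ξ k ω) x)) := by
  filter_upwards [ae_summable_sqrt_blockBound hlaw hindep] with ω hω x
  exact (tendstoUniformly_dyadicSum hω).tendsto_at x

lemma aemeasurable_cosSeries (hlaw : ∀ k, HasLaw (ξ k) (gaussianReal 0 1) P)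
    (hindep : iIndepFun ξ P) (x : ℝ) : AEMeasurable (fun ω => cosSeries (fun k => ξ k ω) x) P :=
  aemeasurable_of_tendsto_metrizable_ae' (f := fun n ω => dyadicSum (fun k => ξ k ω) n x)
    (fun _ => Finset.aemeasurable_fun_sum _ fun k _ => (hlaw k).aemeasurable.mul_const _)
    ((ae_tendsto_dyadicSum hlaw hindep).mono fun _ h => h x)

/-- The increments of the cosine series over a uniform grid of `[a, b] ⊆ [0, π]` with step `h` are
jointly distributed as `√h ξ_0, …, √h ξ_{M-1}`. -/
lemma map_cosSeries_increments (hlaw : ∀ k, HasLaw (ξ k) (gaussianReal 0 1) P)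
    (hindep : iIndepFun ξ P) {a b : ℝ} (ha : 0 ≤ a) (hab : a ≤ b) (hb : b ≤ Real.pi) (M : ℕ) :
    P.map (fun ω (j : Fin M) => cosSeries (fun k => ξ k ω) (gridPoint a b M (j + 1)) -
      cosSeries (fun k => ξ k ω) (gridPoint a b M j)) =
    P.map (fun ω (j : Fin M) => √((b - a) / M) * ξ j ω) := by
  have hh : 0 ≤ (b - a) / M := div_nonneg (sub_nonneg.2 hab) (Nat.cast_nonneg M)
  refine map_eq_of_forall_map_sum_eq
    (aemeasurable_pi_lambda _ fun j => (aemeasurable_cosSeries hlaw hindep _).sub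
      (aemeasurable_cosSeries hlaw hindep _))
    (aemeasurable_pi_lambda _ fun j => (hlaw j).aemeasurable.const_mul _) fun c => ?_
  rw [(map_eq_gaussianReal_of_ae_tendsto hlaw hindep
    (hasSum_sq_sum_cosMode_increments ha hab hb c) ?_).2]
  · symm
    set w : ℕ → ℝ := fun k => if hk : k < M then c ⟨k, hk⟩ * √((b - a) / M) else 0 with hw
    have hwj : ∀ j : Fin M, w j = c j * √((b - a) / M) := fun j => by simp [hw]
    have hw0 : ∀ k ∉ Finset.range M, w k = 0 := fun k hk => by
      simp only [Finset.mem_range] at hk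
      simp [hw, hk]
    have hs : HasSum (fun k => w k ^ 2) ((b - a) / M * ∑ j, c j ^ 2) := by
      have h := hasSum_sum_of_ne_finset_zero (f := fun k => w k ^ 2) (s := Finset.range M)
        (L := SummationFilter.unconditional ℕ)
        fun k hk => by rw [hw0 k hk]; simp
      convert! h using 1
      rw [← Fin.sum_univ_eq_sum_range (fun k => w k ^ 2), Finset.mul_sum]
      refine Finset.sum_congr rfl fun j _ => ?_
      rw [hwj, mul_pow, Real.sq_sqrt hh]
      ring
    refine (map_eq_gaussianReal_of_ae_tendsto hlaw hindep hs (ae_of_all _ fun ω => ?_)).2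
    have h : ∑ j, c j * (√((b - a) / M) * ξ j ω) = ∑ k ∈ Finset.range M, w k * ξ k ω := by
      rw [← Fin.sum_univ_eq_sum_range (fun k => w k * ξ k ω)]
      exact Finset.sum_congr rfl fun j _ => by rw [hwj]; ring
    rw [h]
    refine tendsto_const_nhds.congr' ?_
    filter_upwards [eventually_ge_atTop M] with n hn
    refine Finset.sum_subset (Finset.range_mono (hn.trans Nat.lt_two_pow_self.le)) fun k _ hk => ?_
    rw [hw0 k hk, zero_mul]
  · filter_upwards [ae_tendsto_dyadicSum hlaw hindep] with ω hω
    have h := tendsto_finsetSum (Finset.univ : Finset (Fin M)) fun j _ =>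
      ((hω (gridPoint a b M (j + 1))).sub (hω (gridPoint a b M j))).const_mul (c j)
    refine h.congr fun n => ?_
    simp only [dyadicSum, ← Finset.sum_sub_distrib, Finset.mul_sum, Finset.sum_mul]
    rw [Finset.sum_comm]
    exact Finset.sum_congr rfl fun k _ => Finset.sum_congr rfl fun j _ => by ring

lemma aemeasurable_sumSqIncrements_cosSeries (hlaw : ∀ k, HasLaw (ξ k) (gaussianReal 0 1) P)
    (hindep : iIndepFun ξ P) (a b : ℝ) (M : ℕ) :
    AEMeasurable (fun ω => sumSqIncrements a b M (cosSeries fun k => ξ k ω)) P :=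
  Finset.aemeasurable_fun_sum _ fun _ _ => ((aemeasurable_cosSeries hlaw hindep _).sub
    (aemeasurable_cosSeries hlaw hindep _)).pow_const 2

/-- The normalized quadratic variation is distributed as a mean of squares of the noise. -/
lemma identDistrib_sumSqIncrements (hlaw : ∀ k, HasLaw (ξ k) (gaussianReal 0 1) P)
    (hindep : iIndepFun ξ P) {a b : ℝ} (ha : 0 ≤ a) (hab : a < b) (hb : b ≤ Real.pi) (M : ℕ) :
    IdentDistrib (fun ω => sumSqIncrements a b M (cosSeries fun k => ξ k ω) / (b - a))
      (fun ω => (∑ k ∈ Finset.range M, ξ k ω ^ 2) / M) P P := by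
  have hI : IdentDistrib (fun ω (j : Fin M) =>
      cosSeries (fun k => ξ k ω) (gridPoint a b M (j + 1)) -
        cosSeries (fun k => ξ k ω) (gridPoint a b M j))
      (fun ω (j : Fin M) => √((b - a) / M) * ξ j ω) P P :=
    ⟨aemeasurable_pi_lambda _ fun j => (aemeasurable_cosSeries hlaw hindep _).sub
      (aemeasurable_cosSeries hlaw hindep _),
      aemeasurable_pi_lambda _ fun j => (hlaw j).aemeasurable.const_mul _,
      map_cosSeries_increments hlaw hindep ha hab.le hb M⟩
  have h := hI.comp (u := fun x : Fin M → ℝ => (∑ j, x j ^ 2) / (b - a)) (by fun_prop)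
  convert! h using 1
  · funext ω
    simp only [Function.comp]
    rw [sumSqIncrements_eq, Fin.sum_univ_eq_sum_range (fun j =>
      (cosSeries (fun k => ξ k ω) (gridPoint a b M (j + 1)) -
        cosSeries (fun k => ξ k ω) (gridPoint a b M j)) ^ 2)]
  · funext ω
    simp only [Function.comp, mul_pow]
    rw [Real.sq_sqrt (div_nonneg (sub_nonneg.2 hab.le) (Nat.cast_nonneg M)), ← Finset.mul_sum,
      Fin.sum_univ_eq_sum_range (fun k => ξ k ω ^ 2)]
    have : b - a ≠ 0 := (sub_pos.2 hab).ne'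
    field_simp

end Law

/-! ### Limit theorems for the normalized quadratic variation -/

/-- Convergence in distribution only depends on the laws. -/
lemma tendstoInDistribution_of_map_eq {Ω Ω' Ω'' : Type*} [MeasurableSpace Ω] [MeasurableSpace Ω']
    [MeasurableSpace Ω''] {P : Measure Ω} {P' : Measure Ω'} {P'' : Measure Ω''}
    [IsProbabilityMeasure P] [IsProbabilityMeasure P'] [IsProbabilityMeasure P'']
    {X Y : ℕ → Ω → ℝ} {Z : Ω' → ℝ} {T : Ω'' → ℝ}
    (h : TendstoInDistribution X atTop Z (fun _ => P) P') (hY : ∀ n, AEMeasurable (Y n) P)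
    (hT : AEMeasurable T P'') (hXY : ∀ n, P.map (Y n) = P.map (X n)) (hZT : P''.map T = P'.map Z) :
    TendstoInDistribution Y atTop T (fun _ => P) P'' := by
  refine ⟨hY, hT, ?_⟩
  have h1 := h.tendsto
  have e1 : (fun n => (⟨P.map (X n), Measure.isProbabilityMeasure_map (h.forall_aemeasurable n)⟩ :
      ProbabilityMeasure ℝ)) =
      fun n => ⟨P.map (Y n), Measure.isProbabilityMeasure_map (hY n)⟩ :=
    funext fun n => Subtype.ext (hXY n).symm
  have e2 : (⟨P'.map Z, Measure.isProbabilityMeasure_map h.aemeasurable_limit⟩ :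
      ProbabilityMeasure ℝ) = ⟨P''.map T, Measure.isProbabilityMeasure_map hT⟩ :=
    Subtype.ext hZT.symm
  rw [e1, e2] at h1
  exact h1

section

variable {Ω : Type*} [MeasurableSpace Ω] {P : Measure Ω} {ξ : ℕ → Ω → ℝ}

lemma integral_gaussian_pow_four {X : Ω → ℝ} (hX : HasLaw X (gaussianReal 0 1) P) :
    ∫ ω, X ω ^ 4 ∂P = 3 := by
  rw [integral_pow_of_hasLaw hX, integral_pow_four_gaussianReal]

variable [IsProbabilityMeasure P]

lemma integral_sum_sq_sub_one_pow_four (hlaw : ∀ k, HasLaw (ξ k) (gaussianReal 0 1) P)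
    (hindep : iIndepFun ξ P) :
    ∃ κ : ℝ, 0 ≤ κ ∧ ∀ M : ℕ, ∫ ω, (∑ k ∈ Finset.range M, (ξ k ω ^ 2 - 1)) ^ 4 ∂P =
      3 * M * (M - 1) * 2 ^ 2 + M * κ := by
  have m := fun i => hasAllMoments_of_hasLaw_gaussianReal (hlaw i)
  refine ⟨∫ x, (x ^ 2 - 1) ^ 4 ∂(gaussianReal 0 1), integral_nonneg fun x => by positivity,
    fun M => ?_⟩
  refine (integral_sum_pow_four (X := fun k ω => ξ k ω ^ 2 - 1)
    (fun k => ((m k).pow 2).sub (HasAllMoments.const 1))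
    (hindep.comp (fun _ x => x ^ 2 - 1) fun _ => by fun_prop) (fun k => ?_) (fun k => ?_)
    (fun k => ?_) M).2.2
  · rw [integral_sub ((m k).pow 2).integrable (integrable_const _), integral_gaussian_sq (hlaw k)]
    simp
  · have e : ∀ ω, (ξ k ω ^ 2 - 1) ^ 2 = ξ k ω ^ 4 - 2 * ξ k ω ^ 2 + 1 := fun ω => by ring
    have i1 := ((m k).pow 4).integrable
    have i2 := (((m k).pow 2).const_mul 2).integrable
    have i3 : Integrable (fun ω => ξ k ω ^ 4 - 2 * ξ k ω ^ 2) P := i1.sub i2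
    simp only [e]
    rw [integral_add i3 (integrable_const _), integral_sub i1 i2, integral_const_mul,
      integral_gaussian_sq (hlaw k), integral_gaussian_pow_four (hlaw k)]
    simp
    norm_num
  · rw [← (hlaw k).map_eq, integral_map (hlaw k).aemeasurable (by fun_prop)]

/-- Strong law for the normalized quadratic variation. -/
lemma ae_tendsto_sumSqIncrements_div (hlaw : ∀ k, HasLaw (ξ k) (gaussianReal 0 1) P)
    (hindep : iIndepFun ξ P) {a b : ℝ} (ha : 0 ≤ a) (hab : a < b) (hb : b ≤ Real.pi) :
    ∀ᵐ ω ∂P, Tendsto (fun M : ℕ => sumSqIncrements a b M (cosSeries fun k => ξ k ω) / (b - a))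
      atTop (𝓝 1) := by
  obtain ⟨κ, hκ, hint⟩ := integral_sum_sq_sub_one_pow_four hlaw hindep
  have m := fun i => hasAllMoments_of_hasLaw_gaussianReal (hlaw i)
  have hI : ∀ n : ℕ, IdentDistrib
      (fun ω => (sumSqIncrements a b (n + 1) (cosSeries fun k => ξ k ω) / (b - a) - 1) ^ 4)
      (fun ω => ((∑ k ∈ Finset.range (n + 1), ξ k ω ^ 2) / (n + 1 : ℕ) - 1) ^ 4) P P := fun n =>
    (identDistrib_sumSqIncrements hlaw hindep ha hab hb (n + 1)).comp
      (u := fun x => (x - 1) ^ 4) (by fun_prop)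
  have e : ∀ (n : ℕ) ω, ((∑ k ∈ Finset.range (n + 1), ξ k ω ^ 2) / (n + 1 : ℕ) - 1) ^ 4 =
      ((n + 1 : ℝ) ^ 4)⁻¹ * (∑ k ∈ Finset.range (n + 1), (ξ k ω ^ 2 - 1)) ^ 4 := fun n ω => by
    have hn : (n + 1 : ℝ) ≠ 0 := by positivity
    rw [Finset.sum_sub_distrib]
    simp only [Finset.sum_const, Finset.card_range, nsmul_eq_mul, mul_one]
    push_cast
    rw [← inv_pow, ← mul_pow]
    congr 1
    field_simp
  have hi2 : ∀ n : ℕ, Integrable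
      (fun ω => ((∑ k ∈ Finset.range (n + 1), ξ k ω ^ 2) / (n + 1 : ℕ) - 1) ^ 4) P := fun n => by
    simp only [e]
    exact (((HasAllMoments.sum fun k _ => ((m k).pow 2).sub (HasAllMoments.const 1)).pow
      4).const_mul _).integrable
  have hsum : Summable fun n : ℕ => (12 + κ) * (1 / (n + 1 : ℝ) ^ 2) := by
    have := (summable_nat_add_iff 1).2 (Real.summable_one_div_nat_pow.2 (by norm_num : 1 < 2))
    exact Summable.mul_left _ (by simpa using this)
  have h := ae_summable_of_summable_integral (P := P) (f := fun n ω =>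
    (sumSqIncrements a b (n + 1) (cosSeries fun k => ξ k ω) / (b - a) - 1) ^ 4)
    (fun n ω => by positivity) (fun n => (hI n).integrable_iff.2 (hi2 n)) hsum fun n => by
      rw [(hI n).integral_eq]
      simp only [e]
      rw [integral_const_mul, hint]
      push_cast
      have hn : (0 : ℝ) ≤ n := Nat.cast_nonneg n
      have h1 : 3 * ((n : ℝ) + 1) * (n + 1 - 1) * 2 ^ 2 + (n + 1) * κ ≤
          (12 + κ) * (n + 1 : ℝ) ^ 2 :=
            by nlinarith [mul_nonneg hn hκ, mul_nonneg (mul_nonneg hn hn) hκ]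
      calc ((n + 1 : ℝ) ^ 4)⁻¹ * (3 * ((n : ℝ) + 1) * (n + 1 - 1) * 2 ^ 2 + (n + 1) * κ)
          ≤ ((n + 1 : ℝ) ^ 4)⁻¹ * ((12 + κ) * (n + 1 : ℝ) ^ 2) := by gcongr
        _ = _ := by field_simp
  filter_upwards [h] with ω hω
  rw [← tendsto_add_atTop_iff_nat 1]
  have h0 := hω.tendsto_atTop_zero.sqrt.sqrt
  have e4 : ∀ x : ℝ, √(√(x ^ 4)) = |x| := fun x => by
    rw [show x ^ 4 = (x ^ 2) ^ 2 by ring, Real.sqrt_sq (sq_nonneg x), Real.sqrt_sq_eq_abs]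
  simp only [e4, Real.sqrt_zero] at h0
  have h1 := ((tendsto_zero_iff_abs_tendsto_zero _).2 h0).add_const 1
  simpa using h1

/-- Central limit theorem for the normalized quadratic variation. -/
lemma tendstoInDistribution_sumSqIncrements_div (hlaw : ∀ k, HasLaw (ξ k) (gaussianReal 0 1) P)
    (hindep : iIndepFun ξ P) {a b : ℝ} (ha : 0 ≤ a) (hab : a < b) (hb : b ≤ Real.pi) :
    TendstoInDistribution (fun (M : ℕ) ω =>
      √(M : ℝ) * (sumSqIncrements a b M (cosSeries fun k => ξ k ω) / (b - a) - 1)) atTop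
      (id : ℝ → ℝ) (fun _ => P) (gaussianReal 0 2) := by
  have m := fun i => hasAllMoments_of_hasLaw_gaussianReal (hlaw i)
  have hvar : Var[fun ω => ξ 0 ω ^ 2; P] = 2 := by
    rw [variance_eq_sub ((m 0).pow 2).memLp_two]
    have e : ∀ ω, ((fun ω => ξ 0 ω ^ 2) ^ 2 : Ω → ℝ) ω = ξ 0 ω ^ 4 := fun ω => by
      simp only [Pi.pow_apply]; ring
    simp only [e]
    rw [integral_gaussian_sq (hlaw 0), integral_gaussian_pow_four (hlaw 0)]
    norm_num
  have hid : ∀ k, IdentDistrib (ξ k) (ξ 0) P P := fun k =>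
    ⟨(hlaw k).aemeasurable, (hlaw 0).aemeasurable, by rw [(hlaw k).map_eq, (hlaw 0).map_eq]⟩
  have h := tendstoInDistribution_inv_sqrt_mul_sum_sub (P := P) (P' := gaussianReal 0 2)
    (X := fun k ω => ξ k ω ^ 2) (Y := (id : ℝ → ℝ))
    ⟨aemeasurable_id, by rw [hvar, Measure.map_id]; norm_num⟩ ((m 0).pow 2).memLp_two
    (hindep.comp (fun _ x => x ^ 2) fun _ => by fun_prop)
    (fun k => (hid k).comp (u := fun x => x ^ 2) (by fun_prop))
  refine tendstoInDistribution_of_map_eq h (fun M => ?_) aemeasurable_id (fun M => ?_) rfl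
  · exact (((aemeasurable_sumSqIncrements_cosSeries hlaw hindep a b M).div_const _).sub_const
      _).const_mul _
  · have hI := ((identDistrib_sumSqIncrements hlaw hindep ha hab hb M).comp
      (u := fun x => √(M : ℝ) * (x - 1)) (by fun_prop)).map_eq
    refine hI.trans ?_
    congr 1
    funext ω
    simp only [Function.comp]
    rw [integral_gaussian_sq (hlaw 0)]
    rcases Nat.eq_zero_or_pos M with rfl | hM
    · simp
    · have hM' : (0 : ℝ) < M := by exact_mod_cast hM
      have hs : √(M : ℝ) * √(M : ℝ) = M := Real.mul_self_sqrt hM'.le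
      have hs0 : √(M : ℝ) ≠ 0 := (Real.sqrt_pos.2 hM').ne'
      rw [eq_inv_mul_iff_mul_eq₀ hs0, ← mul_assoc, hs]
      field_simp

end

/-! ### The delta method -/

section Delta

variable {Ω : Type*} [MeasurableSpace Ω] {P : Measure Ω} [IsProbabilityMeasure P] {W : ℕ → Ω → ℝ}

lemma map_mul_gaussianReal_two (c : ℝ) :
    (gaussianReal 0 2).map (fun x => c * x) = gaussianReal 0 (2 * c ^ 2).toNNReal := by
  rw [gaussianReal_map_const_mul, mul_zero]
  congr 1
  ext
  rw [Real.coe_toNNReal _ (by positivity)]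
  push_cast
  simp [mul_comm]

lemma tendstoInDistribution_const_mul
    (h : TendstoInDistribution (fun (M : ℕ) ω => √(M : ℝ) * (W M ω - 1)) atTop (id : ℝ → ℝ)
      (fun _ => P) (gaussianReal 0 2)) (c : ℝ) :
    TendstoInDistribution (fun (M : ℕ) ω => √(M : ℝ) * (c * W M ω - c)) atTop (id : ℝ → ℝ)
      (fun _ => P) (gaussianReal 0 (2 * c ^ 2).toNNReal) := by
  have h1 := h.continuous_comp (g := fun x => c * x) (by fun_prop)
  have e : ∀ M : ℕ, (fun x => c * x) ∘ (fun ω => √(M : ℝ) * (W M ω - 1)) =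
      fun ω => √(M : ℝ) * (c * W M ω - c) := fun M => by
    funext ω
    simp only [Function.comp]
    ring
  refine tendstoInDistribution_of_map_eq h1 (fun M => ?_) aemeasurable_id (fun M => by rw [e M]) ?_
  · rw [← e M]
    exact h1.forall_aemeasurable M
  · rw [Measure.map_id, Function.comp_id, map_mul_gaussianReal_two]

lemma tendstoInDistribution_const_mul_inv (hW : ∀ M, AEMeasurable (W M) P)
    (h1 : ∀ᵐ ω ∂P, Tendsto (fun M => W M ω) atTop (𝓝 1))
    (h : TendstoInDistribution (fun (M : ℕ) ω => √(M : ℝ) * (W M ω - 1)) atTop (id : ℝ → ℝ)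
      (fun _ => P) (gaussianReal 0 2)) (c : ℝ) :
    TendstoInDistribution (fun (M : ℕ) ω => √(M : ℝ) * (c * (W M ω)⁻¹ - c)) atTop (id : ℝ → ℝ)
      (fun _ => P) (gaussianReal 0 (2 * c ^ 2).toNNReal) := by
  have hY : ∀ M, AEMeasurable (fun ω => c * (W M ω)⁻¹) P := fun M => (hW M).inv.const_mul c
  have hYc : TendstoInMeasure P (fun M ω => c * (W M ω)⁻¹) atTop (fun _ => c) := by
    refine tendstoInMeasure_of_tendsto_ae (fun M => (hY M).aestronglyMeasurable) ?_
    filter_upwards [h1] with ω hω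
    simpa using (hω.inv₀ one_ne_zero).const_mul c
  have h2 := h.continuous_comp_prodMk_of_tendstoInMeasure_const
    (g := fun x : ℝ × ℝ => -(x.2 * x.1)) (by fun_prop) hYc hY
  have hm : ∀ M : ℕ, AEMeasurable (fun ω => √(M : ℝ) * (c * (W M ω)⁻¹ - c)) P := fun M =>
    ((hY M).sub_const c).const_mul _
  have h3 := tendstoInDistribution_of_tendstoInMeasure_sub
    (fun (M : ℕ) ω => √(M : ℝ) * (c * (W M ω)⁻¹ - c)) _ h2 ?_ hm
  · refine tendstoInDistribution_of_map_eq h3 hm aemeasurable_id (fun _ => rfl) ?_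
    have e : (fun x : ℝ => -(c * id x)) = fun x => -c * x := by
      funext x
      simp
    rw [Measure.map_id, e, map_mul_gaussianReal_two, neg_sq]
  · refine tendstoInMeasure_of_tendsto_ae (fun M =>
      ((hm M).sub (h2.forall_aemeasurable M)).aestronglyMeasurable) ?_
    filter_upwards [h1] with ω hω
    refine tendsto_const_nhds.congr' ?_
    filter_upwards [hω.eventually_ne one_ne_zero] with M hM
    simp only [Pi.sub_apply, Pi.zero_apply]
    field_simp
    ring

end Delta

/-! ### The estimators -/

section Variation

variable {Ω : Type*} {ξ : ℕ → Ω → ℝ} {θ σ t a b : ℝ}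

/-- The quadratic variation of `u_x`, normalized by its limit `(σ/θ)²(b-a)`. -/
def normalizedVariation (θ σ t a b : ℝ) (ξ : ℕ → Ω → ℝ) (M : ℕ) (ω : Ω) : ℝ :=
  sumSqIncrements a b M (solutionDeriv θ σ ξ t ω) / ((σ / θ) ^ 2 * (b - a))

lemma thetaSqEstimator_eq (hθ : 0 < θ) (M : ℕ) (ω : Ω) :
    thetaSqEstimator σ a b M (solutionDeriv θ σ ξ t ω) =
      θ ^ 2 * (normalizedVariation θ σ t a b ξ M ω)⁻¹ := by
  unfold thetaSqEstimator normalizedVariation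
  rw [inv_div]
  field_simp

lemma sigmaSqEstimator_eq (hθ : 0 < θ) (hσ : 0 < σ) (M : ℕ) (ω : Ω) :
    sigmaSqEstimator θ a b M (solutionDeriv θ σ ξ t ω) =
      σ ^ 2 * normalizedVariation θ σ t a b ξ M ω := by
  unfold sigmaSqEstimator normalizedVariation
  field_simp

end Variation

section Estimators

variable {Ω : Type*} [MeasurableSpace Ω] {P : Measure Ω} [IsProbabilityMeasure P] {ξ : ℕ → Ω → ℝ}
  {θ σ t a b : ℝ}

lemma aemeasurable_solutionDeriv (hlaw : ∀ k, HasLaw (ξ k) (gaussianReal 0 1) P)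
    (hindep : iIndepFun ξ P) (hθ : 0 < θ) (ht : 0 < t) {x : ℝ} (hx : x ∈ Icc 0 Real.pi) :
    AEMeasurable (fun ω => solutionDeriv θ σ ξ t ω x) P := by
  have h : AEMeasurable (fun ω => σ / θ * (cosSeries (fun k => ξ k ω) x -
      dampedSeries θ t (fun k => ξ k ω) x)) P :=
    ((aemeasurable_cosSeries hlaw hindep x).sub (AEMeasurable.tsum fun k =>
      ((hlaw k).aemeasurable.mul_const _).mul_const _)).const_mul _
  refine h.congr ?_
  filter_upwards [ae_summable_abs_div_sq hlaw, ae_summable_sqrt_blockBound hlaw hindep]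
    with ω h1 h2
  exact (solutionDeriv_eq hθ ht h1 h2 hx).symm

lemma aemeasurable_normalizedVariation (hlaw : ∀ k, HasLaw (ξ k) (gaussianReal 0 1) P)
    (hindep : iIndepFun ξ P) (hθ : 0 < θ) (ht : 0 < t) (ha : 0 ≤ a) (hab : a ≤ b)
    (hb : b ≤ Real.pi) (M : ℕ) : AEMeasurable (normalizedVariation θ σ t a b ξ M) P := by
  have hmem : ∀ i ≤ M, gridPoint a b M i ∈ Icc 0 Real.pi := fun i hi =>
    Icc_subset_Icc ha hb (gridPoint_mem_Icc hab hi)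
  refine AEMeasurable.div_const (Finset.aemeasurable_fun_sum _ fun j hj => ?_) _
  rw [Finset.mem_Icc] at hj
  exact ((aemeasurable_solutionDeriv hlaw hindep hθ ht (hmem j hj.2)).sub
    (aemeasurable_solutionDeriv hlaw hindep hθ ht (hmem (j - 1) (by omega)))).pow_const 2

/-- The smooth part of `u_x` contributes `O(1/M)` to the normalized quadratic variation. -/
lemma ae_exists_abs_normalizedVariation_sub_le (hlaw : ∀ k, HasLaw (ξ k) (gaussianReal 0 1) P)
    (hindep : iIndepFun ξ P) (hθ : 0 < θ) (hσ : 0 < σ) (ht : 0 < t) (ha : 0 ≤ a) (hab : a < b)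
    (hb : b ≤ Real.pi) : ∀ᵐ ω ∂P, ∃ K, ∀ M : ℕ, |normalizedVariation θ σ t a b ξ M ω -
      sumSqIncrements a b M (cosSeries fun k => ξ k ω) / (b - a)| ≤ K / M := by
  filter_upwards [ae_summable_abs_div_sq hlaw, ae_summable_sqrt_blockBound hlaw hindep]
    with ω h1 h2
  obtain ⟨K, hK⟩ := exists_abs_sumSqIncrements_solutionDeriv_sub_le (σ := σ) hθ ht ha hab.le hb
    h1 h2
  have hba : 0 < b - a := sub_pos.2 hab
  have hv : 0 < (σ / θ) ^ 2 * (b - a) := by positivity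
  refine ⟨K / ((σ / θ) ^ 2 * (b - a)), fun M => ?_⟩
  have e : normalizedVariation θ σ t a b ξ M ω -
      sumSqIncrements a b M (cosSeries fun k => ξ k ω) / (b - a) =
      (sumSqIncrements a b M (solutionDeriv θ σ ξ t ω) -
        (σ / θ) ^ 2 * sumSqIncrements a b M (cosSeries fun k => ξ k ω)) /
          ((σ / θ) ^ 2 * (b - a)) := by
    unfold normalizedVariation
    field_simp
  rw [e, abs_div, abs_of_pos hv, div_right_comm]
  exact div_le_div_of_nonneg_right (hK M) hv.le

lemma ae_tendsto_normalizedVariation (hlaw : ∀ k, HasLaw (ξ k) (gaussianReal 0 1) P)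
    (hindep : iIndepFun ξ P) (hθ : 0 < θ) (hσ : 0 < σ) (ht : 0 < t) (ha : 0 ≤ a) (hab : a < b)
    (hb : b ≤ Real.pi) :
    ∀ᵐ ω ∂P, Tendsto (fun M => normalizedVariation θ σ t a b ξ M ω) atTop (𝓝 1) := by
  filter_upwards [ae_exists_abs_normalizedVariation_sub_le hlaw hindep hθ hσ ht ha hab hb,
    ae_tendsto_sumSqIncrements_div hlaw hindep ha hab hb] with ω ⟨K, hK⟩ hω
  have h := (squeeze_zero_norm hK (tendsto_const_div_atTop_nhds_zero_nat K)).add hω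
  simpa using h

lemma tendstoInDistribution_normalizedVariation
    (hlaw : ∀ k, HasLaw (ξ k) (gaussianReal 0 1) P)
    (hindep : iIndepFun ξ P) (hθ : 0 < θ) (hσ : 0 < σ) (ht : 0 < t) (ha : 0 ≤ a) (hab : a < b)
    (hb : b ≤ Real.pi) :
    TendstoInDistribution (fun (M : ℕ) ω => √(M : ℝ) * (normalizedVariation θ σ t a b ξ M ω - 1))
      atTop (id : ℝ → ℝ) (fun _ => P) (gaussianReal 0 2) := by
  have h := tendstoInDistribution_sumSqIncrements_div hlaw hindep ha hab hb
  have hm : ∀ M : ℕ, AEMeasurable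
      (fun ω => √(M : ℝ) * (normalizedVariation θ σ t a b ξ M ω - 1)) P := fun M =>
    ((aemeasurable_normalizedVariation hlaw hindep hθ ht ha hab.le hb M).sub_const 1).const_mul _
  refine tendstoInDistribution_of_tendstoInMeasure_sub _ _ h ?_ hm
  refine tendstoInMeasure_of_tendsto_ae (fun M =>
    ((hm M).sub (h.forall_aemeasurable M)).aestronglyMeasurable) ?_
  filter_upwards [ae_exists_abs_normalizedVariation_sub_le hlaw hindep hθ hσ ht ha hab hb]
    with ω ⟨K, hK⟩
  have hlim : Tendsto (fun M : ℕ => K / √(M : ℝ)) atTop (𝓝 0) :=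
    (Real.tendsto_sqrt_atTop.comp tendsto_natCast_atTop_atTop).const_div_atTop K
  refine squeeze_zero_norm (fun M => ?_) hlim
  simp only [Pi.sub_apply]
  rw [← mul_sub, sub_sub_sub_cancel_right, Real.norm_eq_abs, abs_mul,
    abs_of_nonneg (Real.sqrt_nonneg _)]
  refine (mul_le_mul_of_nonneg_left (hK M) (Real.sqrt_nonneg _)).trans_eq ?_
  rw [mul_div_left_comm, Real.sqrt_div_self, div_eq_mul_inv]

end Estimators

end

end SpaceOnlyNoise


theorem mainTheorem5 {Ω : Type*} [MeasurableSpace Ω] (P : Measure Ω) [IsProbabilityMeasure P]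
    (ξ : ℕ → Ω → ℝ) (hlaw : ∀ k, HasLaw (ξ k) (gaussianReal 0 1) P) (hindep : iIndepFun ξ P)
    (θ σ t a b : ℝ) (hθ : 0 < θ) (hσ : 0 < σ) (ht : 0 < t)
    (ha : 0 ≤ a) (hab : a < b) (hb : b ≤ Real.pi) :
    -- almost surely, the series for `u(t, x)` converges and `u(t, ·)` is differentiable on `[0, π]`
    (∀ᵐ ω ∂P, ∀ x ∈ Icc 0 Real.pi,
      Summable (fun k : ℕ => SpaceOnlyNoise.fourierMode θ σ t (k + 1) (ξ k ω) *
        SpaceOnlyNoise.eigenfunction (k + 1) x) ∧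
      DifferentiableWithinAt ℝ (SpaceOnlyNoise.solution θ σ ξ t ω) (Icc 0 Real.pi) x) ∧
    -- `σ` known: the estimator of `θ²` is strongly consistent and asymptotically normal
    (∀ᵐ ω ∂P, Tendsto
      (fun M : ℕ => SpaceOnlyNoise.thetaSqEstimator σ a b M
        (SpaceOnlyNoise.solutionDeriv θ σ ξ t ω)) atTop (𝓝 (θ ^ 2))) ∧
    TendstoInDistribution
      (fun (M : ℕ) (ω : Ω) => √(M : ℝ) * (SpaceOnlyNoise.thetaSqEstimator σ a b M
        (SpaceOnlyNoise.solutionDeriv θ σ ξ t ω) - θ ^ 2))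
      atTop (id : ℝ → ℝ) (fun _ => P) (gaussianReal 0 (Real.toNNReal (2 * θ ^ 4))) ∧
    -- `θ` known: the estimator of `σ²` is strongly consistent and asymptotically normal
    (∀ᵐ ω ∂P, Tendsto
      (fun M : ℕ => SpaceOnlyNoise.sigmaSqEstimator θ a b M
        (SpaceOnlyNoise.solutionDeriv θ σ ξ t ω)) atTop (𝓝 (σ ^ 2))) ∧
    TendstoInDistribution
      (fun (M : ℕ) (ω : Ω) => √(M : ℝ) * (SpaceOnlyNoise.sigmaSqEstimator θ a b M
        (SpaceOnlyNoise.solutionDeriv θ σ ξ t ω) - σ ^ 2))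
      atTop (id : ℝ → ℝ) (fun _ => P) (gaussianReal 0 (Real.toNNReal (2 * σ ^ 4))) := by
  refine ⟨?_, ?_, ?_, ?_, ?_⟩
  · filter_upwards [SpaceOnlyNoise.ae_summable_abs_div_sq hlaw,
      SpaceOnlyNoise.ae_summable_sqrt_blockBound hlaw hindep] with ω h1 h2 x _
    exact ⟨SpaceOnlyNoise.summable_fourierMode_mul_eigenfunction hθ ht h1 x,
      (SpaceOnlyNoise.hasDerivAt_solution hθ ht h1 h2 x).differentiableAt.differentiableWithinAt⟩
  · filter_upwards [SpaceOnlyNoise.ae_tendsto_normalizedVariation hlaw hindep hθ hσ ht ha hab hb]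
      with ω hω
    simp only [SpaceOnlyNoise.thetaSqEstimator_eq hθ]
    simpa using (hω.inv₀ one_ne_zero).const_mul (θ ^ 2)
  · simp only [SpaceOnlyNoise.thetaSqEstimator_eq hθ]
    rw [show θ ^ 4 = (θ ^ 2) ^ 2 by ring]
    exact SpaceOnlyNoise.tendstoInDistribution_const_mul_inv
      (SpaceOnlyNoise.aemeasurable_normalizedVariation hlaw hindep hθ ht ha hab.le hb)
      (SpaceOnlyNoise.ae_tendsto_normalizedVariation hlaw hindep hθ hσ ht ha hab hb)
      (SpaceOnlyNoise.tendstoInDistribution_normalizedVariation hlaw hindep hθ hσ ht ha hab hb) _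
  · filter_upwards [SpaceOnlyNoise.ae_tendsto_normalizedVariation hlaw hindep hθ hσ ht ha hab hb]
      with ω hω
    simp only [SpaceOnlyNoise.sigmaSqEstimator_eq hθ hσ]
    simpa using hω.const_mul (σ ^ 2)
  · simp only [SpaceOnlyNoise.sigmaSqEstimator_eq hθ hσ]
    rw [show σ ^ 4 = (σ ^ 2) ^ 2 by ring]
    exact SpaceOnlyNoise.tendstoInDistribution_const_mul
      (SpaceOnlyNoise.tendstoInDistribution_normalizedVariation hlaw hindep hθ hσ ht ha hab hb) _
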